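/- Let $T$ be the rooted binary tree with vertex set $\{0,1\}^{*}$, and write $(g,h)$ for the automorphism of $T$ fixing the two vertices of level one and acting as $g$ on the left and as $h$ on the right subtree of the root. For $\omega=(\omega_n)_{n\ge 0}\in\{0,1,2\}^{\mathbb N}$ let $a$ be the automorphism exchanging the two subtrees of the root, and let $b_\omega,c_\omega,d_\omega$ be the automorphisms defined recursively by $$b_\omega=(\beta,b_{\tau\omega}),\qquad c_\omega=(\gamma,c_{\tau\omega}),\qquad d_\omega=(\delta,d_{\tau\omega}),$$ where $\tau$ is the shift $(\tau\omega)_n=\omega_{n+1}$ and $(\beta,\gamma,\delta)$ is $(a,a,1)$, $(a,1,a)$ or $(1,a,a)$ according as $\omega_0=0$, $1$ or $2$. Let $G_\omega$ be the Grigorchuk group generated by $S=\{a,b_\omega,c_\omega,d_\omega\}$. For $\omega=012012\dots$ this is the first Grigorchuk group: $b=(a,c)$, $c=(a,d)$, $d=(1,b)$. For a group $G$ with finite generating set $S$ and word metric $d_S(x,y)=l_S(x^{-1}y)$, let $\partial_S V$ be the set of $v\in V$ at distance $1$ from $G\setminus V$, let $\mathrm{F\o l}_{G,S}(n)$ be the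 minimum of $\#V$ over all nonempty finite $V\subset G$ with $\#\partial_S V/\#V\le 1/n$, and let $v_{G,S}(n)=\#\{g\in G: l_S(g)\le n\}$. There is an absolute constant $C>0$ such that for every $\omega\in\{0,1,2\}^{\mathbb N}$ that is not eventually constant (in particular for the first Grigorchuk group) the following hold. 1. For every integer $n\ge 2$ there are nonempty finite sets $V\subset G_\omega$ with $\#\partial_S V/\#V\le 1/n$, so that $\mathrm{F\o l}_{G_\omega,S}(n)$ is well defined, and $$\mathrm{F\o l}_{G_\omega,S}(n)\ \ge\ 2^{Cn}.$$ 2. $G_\omega$ has intermediate growth: $n^{d}=o(v_{G_\omega,S}(n))$ for every $d\in\mathbb N$, and $v_{G_\omega,S}(n)=o(c^{n})$ for every real $c>1$. -/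

import Mathlib

open Filter Asymptotics

section WordMetric

variable {G : Type*} [Group G]

/-- The word length `l_S(g)`: the least length of a word in `S ∪ S⁻¹` representing `g`
(meaningful when `S` generates `G`). -/
noncomputable def wordLength (S : Set G) (g : G) : ℕ :=
  sInf {n : ℕ | ∃ l : List G, (∀ x ∈ l, x ∈ S ∨ x⁻¹ ∈ S) ∧ l.prod = g ∧ l.length = n}

/-- The (left-invariant) word metric `d_S(x, y) = l_S(x⁻¹ y)`. -/
noncomputable def wordDist (S : Set G) (x y : G) : ℕ :=
  wordLength S (x⁻¹ * y)

/-- The boundary `∂_S V`: the elements of `V` at word distance one from the complement of `V`. -/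
def folnerBoundary (S V : Set G) : Set G :=
  {v | v ∈ V ∧ ∃ u, u ∉ V ∧ wordDist S v u = 1}

/-- `F_{G,S}(ε)`: the least cardinality of a nonempty finite set `V ⊆ G` with
`#∂_S V / #V ≤ ε`. If there is no such set, the value is the junk value `0`. -/
noncomputable def isoperimetricMin (S : Set G) (ε : ℝ) : ℕ :=
  sInf {m : ℕ | ∃ V : Finset G, V.Nonempty ∧
    ((folnerBoundary S (V : Set G)).ncard : ℝ) / (V.card : ℝ) ≤ ε ∧ V.card = m}

/-- The Følner function `Føl_{G,S}(n) = F_{G,S}(1/n)`. -/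
noncomputable def folnerFunction (S : Set G) (n : ℕ) : ℕ :=
  isoperimetricMin S (1 / (n : ℝ))

/-- The growth function `v_{G,S}(n)`: the number of elements of word length at most `n`. -/
noncomputable def growthFunction (S : Set G) (n : ℕ) : ℕ :=
  Set.ncard {g : G | wordLength S g ≤ n}

/-- Intermediate growth: faster than every polynomial, slower than every exponential. -/
def HasIntermediateGrowth (S : Set G) : Prop :=
  (∀ d : ℕ, (fun n : ℕ => (n : ℝ) ^ d) =o[atTop] (fun n : ℕ => (growthFunction S n : ℝ))) ∧
  (∀ c : ℝ, 1 < c → (fun n : ℕ => (growthFunction S n : ℝ)) =o[atTop] (fun n : ℕ => c ^ n))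

end WordMetric

section Grigorchuk

/- The vertices of the rooted binary tree are the finite words `List Bool`; the root is `[]`,
and the children of `w` are `w ++ [false]` (left) and `w ++ [true]` (right). -/

/-- The map exchanging the two subtrees of the root. -/
def rootSwap : List Bool → List Bool
  | [] => []
  | x :: w => (!x) :: w

/-- For `p : ℕ → Bool`, the map which fixes the right-most ray `1^∞`, and which acts on the
subtree hanging at `1^n 0` by `rootSwap` if `p n = true` and trivially otherwise. -/
def directedMap : (ℕ → Bool) → List Bool → List Bool
  | _, [] => []
  | p, false :: w => false :: (if p 0 then rootSwap w else w)
  | p, true :: w => true :: directedMap (fun n => p (n + 1)) w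

theorem rootSwap_involutive : Function.Involutive rootSwap := by
  intro w
  cases w <;> simp [rootSwap]

theorem directedMap_involutive (p : ℕ → Bool) : Function.Involutive (directedMap p) := by
  intro w
  induction w generalizing p with
  | nil => rfl
  | cons x w ih =>
    cases x
    · by_cases h : p 0 = true <;> simp [directedMap, h, rootSwap_involutive w]
    · simp [directedMap, ih]

/-- The generator `a`. -/
def grigA : Equiv.Perm (List Bool) := rootSwap_involutive.toPerm

/-- The tree automorphism with underlying map `directedMap p`. -/
def directedPerm (p : ℕ → Bool) : Equiv.Perm (List Bool) := (directedMap_involutive p).toPerm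

/- The symbols `0, 1, 2` stand for the columns `(a, a, 1)`, `(a, 1, a)`, `(1, a, a)` of
left sections of `(b, c, d)`. -/

/-- The generator `b_ω`. -/
def grigB (ω : ℕ → Fin 3) : Equiv.Perm (List Bool) := directedPerm (fun n => decide (ω n ≠ 2))

/-- The generator `c_ω`. -/
def grigC (ω : ℕ → Fin 3) : Equiv.Perm (List Bool) := directedPerm (fun n => decide (ω n ≠ 1))

/-- The generator `d_ω`. -/
def grigD (ω : ℕ → Fin 3) : Equiv.Perm (List Bool) := directedPerm (fun n => decide (ω n ≠ 0))

/-- The Grigorchuk group `G_ω`, generated by `a, b_ω, c_ω, d_ω`. -/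
def grigorchukGroup (ω : ℕ → Fin 3) : Subgroup (Equiv.Perm (List Bool)) :=
  Subgroup.closure {grigA, grigB ω, grigC ω, grigD ω}

/-- The generating set `S = {a, b_ω, c_ω, d_ω}` of `G_ω`, as a subset of the group `G_ω`. -/
def grigorchukGens (ω : ℕ → Fin 3) : Set (grigorchukGroup ω) :=
  {g | (g : Equiv.Perm (List Bool)) ∈
    ({grigA, grigB ω, grigC ω, grigD ω} : Set (Equiv.Perm (List Bool)))}

/- Sanity checks: `S` generates `G_ω`, the generators are automorphisms of the rooted tree,
and for `ω = 012012…` they satisfy the recursion that defines the first Grigorchuk group. -/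

theorem closure_grigorchukGens (ω : ℕ → Fin 3) : Subgroup.closure (grigorchukGens ω) = ⊤ :=
  Subgroup.closure_closure_coe_preimage

theorem rootSwap_prefix {u v : List Bool} (h : u <+: v) : rootSwap u <+: rootSwap v := by
  obtain ⟨t, rfl⟩ := h
  cases u <;> simp [rootSwap]

theorem directedMap_prefix (p : ℕ → Bool) {u v : List Bool} (h : u <+: v) :
    directedMap p u <+: directedMap p v := by
  obtain ⟨t, rfl⟩ := h
  induction u generalizing p with
  | nil => simp [directedMap]
  | cons x u ih =>
    cases x
    · by_cases h : p 0 = true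
      · simpa [directedMap, h] using rootSwap_prefix (List.prefix_append u t)
      · simp [directedMap, h]
    · simpa [directedMap] using ih (fun n => p (n + 1))

/-- The sequence `012012…`; `G_ω` for this `ω` is the first Grigorchuk group. -/
def firstGrigorchukSeq (n : ℕ) : Fin 3 := ⟨n % 3, Nat.mod_lt n (by norm_num)⟩

theorem firstGrigorchukSeq_not_eventuallyConst : ¬ EventuallyConst firstGrigorchukSeq atTop := by
  intro h
  obtain ⟨N, hN⟩ := eventuallyConst_atTop.1 h
  have h1 := congrArg Fin.val (hN (N + 1) (by omega))
  simp only [firstGrigorchukSeq] at h1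
  omega

/-- The pair `(g, h)`: it acts by `g` on the left subtree and by `h` on the right subtree. -/
def sectionPair (g h : List Bool → List Bool) : List Bool → List Bool
  | [] => []
  | false :: w => false :: g w
  | true :: w => true :: h w

theorem firstGrigorchuk_b : ⇑(grigB firstGrigorchukSeq) =
    sectionPair grigA (grigC firstGrigorchukSeq) := by
  have key : (fun n => decide (firstGrigorchukSeq (n + 1) ≠ 2)) =
      (fun n => decide (firstGrigorchukSeq n ≠ 1)) := by
    funext n
    simp only [firstGrigorchukSeq, ne_eq, Fin.ext_iff, Fin.val_two, Fin.val_one]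
    congr 1
    apply propext
    omega
  funext w
  match w with
  | [] => rfl
  | false :: w => rfl
  | true :: w =>
    change true :: directedMap _ w = true :: directedMap _ w
    rw [key]

theorem firstGrigorchuk_c : ⇑(grigC firstGrigorchukSeq) =
    sectionPair grigA (grigD firstGrigorchukSeq) := by
  have key : (fun n => decide (firstGrigorchukSeq (n + 1) ≠ 1)) =
      (fun n => decide (firstGrigorchukSeq n ≠ 0)) := by
    funext n
    simp only [firstGrigorchukSeq, ne_eq, Fin.ext_iff, Fin.val_zero, Fin.val_one]
    congr 1
    apply propext
    omega
  funext w
  match w with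
  | [] => rfl
  | false :: w => rfl
  | true :: w =>
    change true :: directedMap _ w = true :: directedMap _ w
    rw [key]

theorem firstGrigorchuk_d : ⇑(grigD firstGrigorchukSeq) =
    sectionPair id (grigB firstGrigorchukSeq) := by
  have key : (fun n => decide (firstGrigorchukSeq (n + 1) ≠ 0)) =
      (fun n => decide (firstGrigorchukSeq n ≠ 2)) := by
    funext n
    simp only [firstGrigorchukSeq, ne_eq, Fin.ext_iff, Fin.val_zero, Fin.val_two]
    congr 1
    apply propext
    omega
  funext w
  match w with
  | [] => rfl
  | false :: w => rfl
  | true :: w =>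
    change true :: directedMap _ w = true :: directedMap _ w
    rw [key]

end Grigorchuk

/-! Lower bound for the Følner function. Suppose each of m group elements moves a point that all the
others fix. They then behave like independent directions of a cube: a finite nonempty set in which
every element has d neighbours along them has at least 2^d elements (`two_pow_le_card_of_degree`).
If the boundary of V is at most 1/n of V, right translation by a word of length at most n/2 keeps at
least half of V inside V. V then carries at least half of all possible edges, and pruning vertices
of low degree leaves a nonempty subset of minimal degree about m/4.

In G_ω there are 2^k such elements of length O(2^k) for every k (`exists_independent_words`), so m
can be taken proportional to n. They come from the substitution a ↦ a y a. Its right section is the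
original word, while its left section lies in a group generated by two involutions. That group is
metabelian, so a double commutator lifts to an element acting on the right subtree only. Iterating
gives an element supported below 1^k, and conjugating it reaches every vertex of level k.

Growth. The letters counted in a word are split between its two sections, so families of elements
built from such pairs have no larger exponential rate. If the common rate bound of all G_ω is r > 1,
most slots of a typical word would have to hold one fixed letter, which leaves too few words; so r
can be lowered (`rateLE_swapBall_improve`), and the least rate bound is 1. Subexponential growth
makes some balls Følner sets. Conversely, if balls up to radius n were all smaller than Føl(√n),
they would grow by a factor 1 + 1/√n at each step; hence the growth is at least 2^(C√n), which is
superpolynomial. -/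

open scoped commutatorElement

/-! ### Independent directions force exponentially large sets. -/

section Cubes

variable {G X ι : Type*} [Group G] [MulAction G X] [DecidableEq G]

/-- If `t i` moves `u i` and fixes the other `u j`, then a finite nonempty set in which every
element has `d` neighbours in distinct directions `t i` has at least `2 ^ d` elements. -/
theorem two_pow_le_card_of_degree {t : ι → G} {u : ι → X} (h1 : ∀ i, t i • u i ≠ u i)
    (h2 : ∀ i j, i ≠ j → t i • u j = u j) (d : ℕ) (I : Finset ι) (S : Finset G)
    (hS : S.Nonempty)
    (hd : ∀ s ∈ S, d ≤ (I.filter fun i => s * t i ∈ S ∨ s * (t i)⁻¹ ∈ S).card) :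
    2 ^ d ≤ S.card := by
  classical
  induction d generalizing I S with
  | zero => simpa using hS.card_pos
  | succ d ih =>
    obtain ⟨s, hs⟩ := hS
    obtain ⟨i, hi⟩ := Finset.card_pos.1 (lt_of_lt_of_le (Nat.succ_pos d) (hd s hs))
    simp only [Finset.mem_filter] at hi
    have h2' : ∀ i j, i ≠ j → (t i)⁻¹ • u j = u j := fun i j hij => by
      rw [inv_smul_eq_iff, h2 i j hij]
    have h1' : (t i)⁻¹ • u i ≠ u i := fun h => h1 i (by rw [inv_smul_eq_iff] at h; exact h.symm)
    -- Cut `S` according to the position of `g • u i`. For `j ≠ i`, right multiplication by `t j`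
    -- does not change `g • u i`, so each piece loses at most the direction `i`, and the induction
    -- hypothesis applies to it.
    have key : ∀ (p : X → Prop) [DecidablePred p], (S.filter fun g => p (g • u i)).Nonempty →
        2 ^ d ≤ (S.filter fun g => p (g • u i)).card := by
      intro p _ hp
      refine ih (I.erase i) _ hp fun g hg => ?_
      simp only [Finset.mem_filter] at hg
      have := hd g hg.1
      refine Nat.le_of_succ_le_succ (this.trans ?_)
      refine (Finset.card_le_card (t := insert i ((I.erase i).filter fun j =>
        g * t j ∈ (S.filter fun g => p (g • u i)) ∨
          g * (t j)⁻¹ ∈ (S.filter fun g => p (g • u i)))) ?_).trans (Finset.card_insert_le _ _)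
      intro j hj
      by_cases hij : j = i
      · simp [hij]
      · simp only [Finset.mem_filter, Finset.mem_insert, Finset.mem_erase, mul_smul,
          h2 j i hij, h2' j i hij] at hj ⊢
        exact Or.inr ⟨⟨hij, hj.1⟩, hj.2.imp (fun h => ⟨h, hg.2⟩) (fun h => ⟨h, hg.2⟩)⟩
    -- Both pieces are nonempty: `s` lies in one, and its neighbour in the direction `i` lies in the
    -- other. This doubles the bound.
    have hA := key (fun x => x = s • u i) ⟨s, by simp [hs]⟩
    have hB := key (fun x => ¬ x = s • u i) (by
      rcases hi.2 with h | h
      · exact ⟨_, Finset.mem_filter.2 ⟨h, by simpa [mul_smul] using h1 i⟩⟩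
      · exact ⟨_, Finset.mem_filter.2 ⟨h, by simpa [mul_smul] using h1'⟩⟩)
    have := Finset.card_filter_add_card_filter_not (s := S) (fun g => g • u i = s • u i)
    rw [pow_succ]
    omega

/-- The number of pairs `(i, s)` with `s` and `s * t i` in `S`. -/
def edgeCount (t : ι → G) (I : Finset ι) (S : Finset G) : ℕ :=
  ∑ i ∈ I, (S.filter fun s => s * t i ∈ S).card

/-- The factor 2 appears because, in each direction, `s` can be the source of one edge and the
target of another. -/
theorem edgeCount_le_erase (t : ι → G) (I : Finset ι) (S : Finset G) (s : G) :
    edgeCount t I S ≤ edgeCount t I (S.erase s) +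
      2 * (I.filter fun i => s * t i ∈ S ∨ s * (t i)⁻¹ ∈ S).card := by
  classical
  have h : ∀ i ∈ I, (S.filter fun g => g * t i ∈ S).card ≤
      ((S.erase s).filter fun g => g * t i ∈ S.erase s).card +
        2 * (if s * t i ∈ S ∨ s * (t i)⁻¹ ∈ S then 1 else 0) := by
    intro i _
    split_ifs with hi
    · refine (Finset.card_le_card (t := ((S.erase s).filter fun g => g * t i ∈ S.erase s) ∪
        {s, s * (t i)⁻¹}) ?_).trans ((Finset.card_union_le _ _).trans
          (Nat.add_le_add_left Finset.card_le_two _))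
      intro g hg
      simp only [Finset.mem_filter, Finset.mem_union, Finset.mem_erase, Finset.mem_insert,
        Finset.mem_singleton] at hg ⊢
      by_cases hgs : g = s
      · simp [hgs]
      · by_cases hgt : g * t i = s
        · right; right; rw [← hgt]; group
        · exact Or.inl ⟨⟨hgs, hg.1⟩, hgt, hg.2⟩
    · push Not at hi
      refine Finset.card_le_card fun g hg => ?_
      simp only [Finset.mem_filter, Finset.mem_erase] at hg ⊢
      refine ⟨⟨?_, hg.1⟩, ?_, hg.2⟩
      · rintro rfl; exact hi.1 hg.2
      · intro h; apply hi.2; rw [← h]; simpa using hg.1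
  refine (Finset.sum_le_sum h).trans (le_of_eq ?_)
  rw [Finset.sum_add_distrib, ← Finset.mul_sum, Finset.card_filter]
  rfl

/-- Delete vertices of degree less than d one at a time. Each deletion costs at most 2(d - 1) edges,
and 4(d - 1) < #I, so the edge density is preserved. The process stops at a nonempty set of minimal
degree at least d. -/
theorem two_pow_le_card_of_edgeCount {t : ι → G} {u : ι → X} (h1 : ∀ i, t i • u i ≠ u i)
    (h2 : ∀ i j, i ≠ j → t i • u j = u j) (d : ℕ) (I : Finset ι) (hI : 4 * d ≤ I.card + 3)
    (V : Finset G) (hV : V.Nonempty) (hE : I.card * V.card ≤ 2 * edgeCount t I V) :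
    2 ^ d ≤ V.card := by
  classical
  induction hn : V.card using Nat.strong_induction_on generalizing V with
  | _ n ih =>
  subst hn
  by_cases hmin : ∀ s ∈ V, d ≤ (I.filter fun i => s * t i ∈ V ∨ s * (t i)⁻¹ ∈ V).card
  · exact two_pow_le_card_of_degree h1 h2 d I V hV hmin
  · push Not at hmin
    obtain ⟨s, hs, hlt⟩ := hmin
    have h3 := edgeCount_le_erase t I V s
    have h4 := Finset.card_erase_add_one hs
    have h5 : I.card * (V.erase s).card ≤ 2 * edgeCount t I (V.erase s) := by
      rw [← h4, mul_add] at hE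
      omega
    rcases (V.erase s).eq_empty_or_nonempty with h0 | hne
    -- Pruning never exhausts `V`: a singleton has no edges, because `t i` moves a point and so is
    -- not 1, and this contradicts the density bound.
    · obtain ⟨i, hi⟩ : ∃ i, i ∈ I := by
        by_contra! hc
        have : I.card = 0 := by simpa using Finset.eq_empty_of_forall_notMem hc
        omega
      have hz : edgeCount t I V = 0 := by
        unfold edgeCount
        refine Finset.sum_eq_zero fun i _ => ?_
        rw [Finset.card_eq_zero, Finset.filter_eq_empty_iff]
        intro g hg hgt
        have hV1 : V = {s} := by
          rw [← Finset.insert_erase hs, h0]; rfl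
        rw [hV1, Finset.mem_singleton] at hg hgt
        apply h1 i
        have : t i = 1 := by subst hg; simpa using hgt
        rw [this, one_smul]
      rw [hz] at hE
      have := hV.card_pos
      have := Finset.card_pos.2 ⟨i, hi⟩
      nlinarith
    · exact (ih _ (by omega) _ hne h5 rfl).trans (by omega)

end Cubes

/-! ### Word metric, boundaries and growth in a finitely generated group. -/

section WordMetricLemmas

variable {G : Type*} [Group G]

theorem wordLength_le_length {S : Set G} {l : List G} (hl : ∀ x ∈ l, x ∈ S ∨ x⁻¹ ∈ S) :
    wordLength S l.prod ≤ l.length :=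
  Nat.sInf_le ⟨l, hl, rfl, rfl⟩

theorem exists_list_prod_eq {S : Set G} (hS : Subgroup.closure S = ⊤) (g : G) :
    ∃ l : List G, (∀ x ∈ l, x ∈ S ∨ x⁻¹ ∈ S) ∧ l.prod = g ∧ l.length = wordLength S g := by
  have : {n : ℕ | ∃ l : List G, (∀ x ∈ l, x ∈ S ∨ x⁻¹ ∈ S) ∧ l.prod = g ∧
      l.length = n}.Nonempty := by
    have hg : g ∈ Subgroup.closure S := hS ▸ Subgroup.mem_top g
    rw [← Subgroup.mem_toSubmonoid, Subgroup.closure_toSubmonoid] at hg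
    obtain ⟨l, h1, h2⟩ := Submonoid.exists_list_of_mem_closure hg
    exact ⟨_, l, h1, h2, rfl⟩
  exact Nat.sInf_mem this

theorem wordLength_one (S : Set G) : wordLength S 1 = 0 := by
  have := wordLength_le_length (S := S) (l := []) (by simp)
  simpa using this

theorem wordLength_mul_le {S : Set G} (hS : Subgroup.closure S = ⊤) (g h : G) :
    wordLength S (g * h) ≤ wordLength S g + wordLength S h := by
  obtain ⟨l, hl, hp, hn⟩ := exists_list_prod_eq hS g
  obtain ⟨l', hl', hp', hn'⟩ := exists_list_prod_eq hS h
  have := wordLength_le_length (S := S) (l := l ++ l') (by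
    intro x hx; rcases List.mem_append.1 hx with h | h
    · exact hl x h
    · exact hl' x h)
  rw [List.prod_append, List.length_append, hp, hp', hn, hn'] at this
  exact this

theorem mem_folnerBoundary {S V : Set G} {v x : G} (hv : v ∈ V) (hx : x ∈ S) (hvx : v * x ∉ V) :
    v ∈ folnerBoundary S V := by
  refine ⟨hv, v * x, hvx, ?_⟩
  have hx1 : x ≠ 1 := by rintro rfl; simp_all
  unfold wordDist
  rw [inv_mul_cancel_left]
  have h1 : wordLength S x ≤ 1 := by
    simpa using wordLength_le_length (S := S) (l := [x]) (by simp [hx])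
  refine le_antisymm h1 (Nat.one_le_iff_ne_zero.2 fun h0 => ?_)
  have hmem := Nat.sInf_mem (s := {n : ℕ | ∃ l : List G, (∀ y ∈ l, y ∈ S ∨ y⁻¹ ∈ S) ∧
    l.prod = x ∧ l.length = n}) ⟨1, [x], by simp [hx], by simp, rfl⟩
  obtain ⟨l, -, hl, hn⟩ := hmem
  have hl0 : l.length = 0 := hn.trans h0
  rw [List.length_eq_zero_iff] at hl0
  subst hl0
  exact hx1 (by simpa using hl.symm)

theorem folnerBoundary_subset (S V : Set G) : folnerBoundary S V ⊆ V := fun _ h => h.1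

/-- A walk along the word that starts in `V` and ends outside must leave `V` at some step, from a
boundary point. For a fixed step, that point determines the start. -/
theorem card_filter_mul_prod_notMem_le [DecidableEq G] {S : Set G} (V : Finset G) (l : List G)
    (hl : ∀ x ∈ l, x ∈ S) : (V.filter fun v => v * l.prod ∉ V).card ≤
      l.length * (folnerBoundary S (V : Set G)).ncard := by
  classical
  induction l with
  | nil => simp
  | cons x l ih =>
    have ih := ih fun y hy => hl y (List.mem_cons_of_mem _ hy)
    have hfin : (folnerBoundary S (V : Set G)).Finite :=
      V.finite_toSet.subset (folnerBoundary_subset _ _)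
    have hsub : (V.filter fun v => v * (x :: l).prod ∉ V) ⊆ hfin.toFinset ∪
        (V.filter fun v => v * l.prod ∉ V).image (fun v => v * x⁻¹) := by
      intro v hv
      rw [Finset.mem_filter, List.prod_cons] at hv
      simp only [Finset.mem_filter, Finset.mem_union, Set.Finite.mem_toFinset,
        Finset.mem_image]
      by_cases hvx : v * x ∈ V
      · exact Or.inr ⟨v * x, ⟨hvx, by rw [mul_assoc]; exact hv.2⟩, by group⟩
      · exact Or.inl (mem_folnerBoundary (V := (V : Set G)) hv.1 (hl x (by simp)) hvx)
    refine (Finset.card_le_card hsub).trans ((Finset.card_union_le _ _).trans ?_)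
    rw [← Set.ncard_eq_toFinset_card _ hfin, List.length_cons, add_mul, one_mul, add_comm]
    exact Nat.add_le_add_right (Finset.card_image_le.trans ih) _

/-- A finite set whose boundary is at most `1 / n` of it is exponentially large in `m` if there are
`m` words of length at most `n / 2` moving `m` points independently. -/
theorem two_pow_le_card_of_boundary [DecidableEq G] {X ι : Type*} [MulAction G X] [Fintype ι]
    {S : Set G} {t : ι → List G} {u : ι → X} {n : ℕ} (ht : ∀ i, ∀ x ∈ t i, x ∈ S)
    (hn : ∀ i, 2 * (t i).length ≤ n)
    (h1 : ∀ i, (t i).prod • u i ≠ u i) (h2 : ∀ i j, i ≠ j → (t i).prod • u j = u j) (d : ℕ)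
    (hd : 4 * d ≤ Fintype.card ι + 3) (V : Finset G) (hV : V.Nonempty)
    (hb : n * (folnerBoundary S (V : Set G)).ncard ≤ V.card) : 2 ^ d ≤ V.card := by
  classical
  refine two_pow_le_card_of_edgeCount (t := fun i => (t i).prod) h1 h2 d Finset.univ hd V hV ?_
  have h : ∀ i ∈ (Finset.univ : Finset ι),
      V.card ≤ 2 * (V.filter fun v => v * (t i).prod ∈ V).card := by
    intro i _
    have h3 := card_filter_mul_prod_notMem_le V (t i) (ht i)
    have h4 := Finset.card_filter_add_card_filter_not (s := V) (fun v => v * (t i).prod ∈ V)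
    have h5 := Nat.mul_le_mul_right (folnerBoundary S (V : Set G)).ncard (hn i)
    rw [mul_assoc] at h5
    omega
  have := Finset.sum_le_sum h
  rw [Finset.sum_const, smul_eq_mul, ← Finset.mul_sum] at this
  exact this

theorem finite_ball {S : Set G} (hfin : S.Finite) (hS : Subgroup.closure S = ⊤) (n : ℕ) :
    {g : G | wordLength S g ≤ n}.Finite := by
  have hT : (S ∪ S⁻¹).Finite := hfin.union hfin.inv
  have := (List.finite_length_le hT.toFinset n)
  refine (((List.finite_length_le hT.toFinset n).image
    fun l => (l.map Subtype.val).prod)).subset ?_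
  intro g hg
  obtain ⟨l, hl, hp, hn⟩ := exists_list_prod_eq hS g
  refine ⟨l.attach.map fun x => ⟨x.1, by simpa using hl x.1 x.2⟩, ?_, ?_⟩
  · simpa [hn] using hg
  · simp [List.map_map, Function.comp_def, hp]

theorem growthFunction_pos {S : Set G} (hfin : S.Finite) (hS : Subgroup.closure S = ⊤) (n : ℕ) :
    0 < growthFunction S n :=
  (Set.ncard_pos (finite_ball hfin hS n)).2 ⟨1, by simp [wordLength_one]⟩

/-- A neighbour of an element of length at most r still has length at most r + 1, so the boundary of
the larger ball avoids the smaller one. -/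
theorem ncard_folnerBoundary_ball_add {S : Set G} (hfin : S.Finite)
    (hS : Subgroup.closure S = ⊤) (r : ℕ) :
    (folnerBoundary S {g : G | wordLength S g ≤ r + 1}).ncard + growthFunction S r ≤
      growthFunction S (r + 1) := by
  have hf := finite_ball hfin hS
  have hdisj : Disjoint (folnerBoundary S {g : G | wordLength S g ≤ r + 1})
      {g : G | wordLength S g ≤ r} := by
    rw [Set.disjoint_left]
    rintro v ⟨-, u, hu, hd⟩ hv
    apply hu
    have := wordLength_mul_le hS v (v⁻¹ * u)
    rw [mul_inv_cancel_left] at this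
    unfold wordDist at hd
    simp only [Set.mem_ofPred_eq] at hv ⊢
    omega
  unfold growthFunction
  rw [← Set.ncard_union_eq hdisj ((hf _).subset (folnerBoundary_subset _ _)) (hf _)]
  refine Set.ncard_le_ncard (Set.union_subset (folnerBoundary_subset _ _) ?_) (hf _)
  intro g hg
  exact le_trans hg (Nat.le_succ r)

/-- If no ball of radius at most `N` is a Følner set for `1 / k`, the balls grow exponentially. -/
theorem pow_le_growthFunction {S : Set G} (hfin : S.Finite) (hS : Subgroup.closure S = ⊤)
    {k : ℕ} (hk : 0 < k) (N : ℕ)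
    (h : ∀ V : Finset G, V.Nonempty → V.card ≤ growthFunction S N →
      ¬ ((folnerBoundary S (V : Set G)).ncard : ℝ) / (V.card : ℝ) ≤ 1 / (k : ℝ)) :
    (1 + 1 / (k : ℝ)) ^ N ≤ growthFunction S N := by
  have hf := finite_ball hfin hS
  have hmono : ∀ r s, r ≤ s → growthFunction S r ≤ growthFunction S s := fun r s hrs =>
    Set.ncard_le_ncard (fun g hg => le_trans hg hrs) (hf _)
  have hk' : (0 : ℝ) < k := by exact_mod_cast hk
  suffices H : ∀ r ≤ N, (1 + 1 / (k : ℝ)) ^ r ≤ growthFunction S r from H N le_rfl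
  intro r
  induction r with
  | zero =>
    intro _
    have := growthFunction_pos hfin hS 0
    simpa using (Nat.one_le_iff_ne_zero.2 this.ne')
  | succ r ih =>
    intro hr
    have ih := ih (by omega)
    have hcard : (hf (r + 1)).toFinset.card = growthFunction S (r + 1) :=
      (Set.ncard_eq_toFinset_card _ _).symm
    have h1 := h (hf (r + 1)).toFinset ⟨1, by simp [wordLength_one]⟩
      (by rw [hcard]; exact hmono _ _ hr)
    have hpos : (0 : ℝ) < growthFunction S (r + 1) := by
      exact_mod_cast growthFunction_pos hfin hS _
    rw [hcard, Set.Finite.coe_toFinset, not_le, div_lt_div_iff₀ hk' hpos, one_mul] at h1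
    have h2 : ((folnerBoundary S {g : G | wordLength S g ≤ r + 1}).ncard : ℝ) +
        growthFunction S r ≤ growthFunction S (r + 1) := by
      exact_mod_cast ncard_folnerBoundary_ball_add hfin hS r
    -- The boundary exceeds v(r+1)/k, so v(r+1) ≥ v(r) + v(r+1)/k ≥ (1 + 1/k) v(r).
    have h3 : (growthFunction S r : ℝ) * (k + 1) ≤ growthFunction S (r + 1) * k := by
      have h4 : (growthFunction S r : ℝ) ≤ growthFunction S (r + 1) := by
        exact_mod_cast hmono _ _ (Nat.le_succ r)
      nlinarith
    rw [pow_succ]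
    refine (mul_le_mul_of_nonneg_right ih (by positivity)).trans ?_
    rw [show (1 + 1 / (k : ℝ)) = (k + 1) / k by field_simp, ← mul_div_assoc, div_le_iff₀ hk']
    exact h3

theorem exists_folner_of_subexponential {S : Set G} (hfin : S.Finite)
    (hS : Subgroup.closure S = ⊤)
    (hsub : ∀ c : ℝ, 1 < c → (fun n : ℕ => (growthFunction S n : ℝ)) =o[atTop] (fun n : ℕ => c ^ n))
    {k : ℕ} (hk : 0 < k) : ∃ V : Finset G, V.Nonempty ∧
      ((folnerBoundary S (V : Set G)).ncard : ℝ) / (V.card : ℝ) ≤ 1 / (k : ℝ) := by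
  by_contra! hc
  have hk' : (0 : ℝ) < k := by exact_mod_cast hk
  have h1 := hsub (1 + 1 / (k : ℝ)) (by simp [hk])
  have h2 := (h1.bound (c := 1 / 2) (by norm_num)).exists
  obtain ⟨N, hN⟩ := h2
  have h3 := pow_le_growthFunction hfin hS hk N fun V hV _ => not_le.2 (hc V hV)
  have hp : (0 : ℝ) < (1 + 1 / (k : ℝ)) ^ N := by positivity
  rw [Real.norm_of_nonneg (by positivity), Real.norm_of_nonneg hp.le] at hN
  linarith

theorem two_pow_le_one_add_inv_pow {k N : ℕ} (hk : 0 < k) (hN : k * k ≤ N) :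
    (2 : ℝ) ^ k ≤ (1 + 1 / (k : ℝ)) ^ N := by
  have hk' : (0 : ℝ) < k := by exact_mod_cast hk
  have h1 : (1 : ℝ) ≤ 1 + 1 / (k : ℝ) := by simp
  refine le_trans ?_ (pow_le_pow_right₀ h1 hN)
  rw [pow_mul]
  refine pow_le_pow_left₀ (by norm_num) ?_ k
  have := one_add_mul_le_pow (a := 1 / (k : ℝ)) (by have : 0 ≤ 1 / (k : ℝ) := by positivity
                                                    linarith) k
  rw [mul_one_div_cancel hk'.ne'] at this
  linarith

/-- An exponential lower bound for the Følner function forces superpolynomial growth. -/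
theorem pow_isLittleO_growthFunction {S : Set G} (hfin : S.Finite) (hS : Subgroup.closure S = ⊤)
    {C : ℝ} (hC : 0 < C) (hC1 : C ≤ 1)
    (hF : ∀ n : ℕ, 2 ≤ n → (2 : ℝ) ^ (C * (n : ℝ)) ≤ (folnerFunction S n : ℝ)) (d : ℕ) :
    (fun n : ℕ => (n : ℝ) ^ d) =o[atTop] (fun n : ℕ => (growthFunction S n : ℝ)) := by
  have hr : (1 : ℝ) < 2 ^ C := Real.one_lt_rpow (by norm_num) hC
  have hsq : Tendsto Nat.sqrt atTop atTop := by
    refine tendsto_atTop.2 fun b => ?_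
    filter_upwards [eventually_ge_atTop (b * b)] with n hn
    exact Nat.le_sqrt.2 hn
  -- Take k = ⌊√n⌋. If v(n) < 2^(Ck) ≤ Føl(k), no ball of radius at most n is a Følner set for 1/k,
  -- so v(n) ≥ (1 + 1/k)^n ≥ 2^k, which contradicts C ≤ 1.
  have hlow : ∀ᶠ n : ℕ in atTop, ((2 : ℝ) ^ C) ^ (Nat.sqrt n) ≤ growthFunction S n := by
    filter_upwards [hsq.eventually_ge_atTop 2] with n hn
    set k := Nat.sqrt n with hkdef
    have hpow : ((2 : ℝ) ^ C) ^ k = 2 ^ (C * (k : ℝ)) := by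
      rw [Real.rpow_mul (by norm_num), Real.rpow_natCast]
    rw [hpow]
    by_contra! hlt
    have h1 := pow_le_growthFunction hfin hS (k := k) (by omega) n (by
      intro V hV hcard hle
      have h2 : folnerFunction S k ≤ V.card := Nat.sInf_le ⟨V, hV, hle, rfl⟩
      have h3 : (folnerFunction S k : ℝ) ≤ growthFunction S n := by
        exact_mod_cast h2.trans hcard
      linarith [hF k hn])
    have h2 := two_pow_le_one_add_inv_pow (k := k) (N := n) (by omega) (Nat.sqrt_le n)
    have h3 : (2 : ℝ) ^ (C * (k : ℝ)) ≤ 2 ^ k := by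
      rw [← Real.rpow_natCast]
      refine Real.rpow_le_rpow_of_exponent_le (by norm_num) ?_
      nlinarith [(Nat.cast_nonneg k : (0 : ℝ) ≤ k)]
    linarith
  have hO : (fun n : ℕ => ((2 : ℝ) ^ C) ^ (Nat.sqrt n)) =O[atTop]
      (fun n : ℕ => (growthFunction S n : ℝ)) := by
    refine IsBigO.of_bound 1 ?_
    filter_upwards [hlow] with n hn
    rw [Real.norm_of_nonneg (by positivity), Real.norm_of_nonneg (by positivity), one_mul]
    exact hn
  have hpoly : (fun n : ℕ => (n : ℝ) ^ d) =O[atTop]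
      (fun n : ℕ => ((Nat.sqrt n : ℕ) : ℝ) ^ (2 * d)) := by
    refine IsBigO.of_bound (4 ^ d) ?_
    filter_upwards [hsq.eventually_ge_atTop 1] with n hn
    rw [Real.norm_of_nonneg (by positivity), Real.norm_of_nonneg (by positivity), pow_mul,
      ← mul_pow]
    refine pow_le_pow_left₀ (by positivity) ?_ d
    have h1 : n < (Nat.sqrt n + 1) * (Nat.sqrt n + 1) := Nat.lt_succ_sqrt n
    have h2 : (n : ℝ) < (Nat.sqrt n + 1) * (Nat.sqrt n + 1) := by exact_mod_cast h1
    have h3 : (1 : ℝ) ≤ Nat.sqrt n := by exact_mod_cast hn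
    nlinarith
  have hexp := (isLittleO_pow_const_const_pow_of_one_lt (R := ℝ) (2 * d) hr).comp_tendsto hsq
  exact hpoly.trans_isLittleO (hexp.trans_isBigO hO)

end WordMetricLemmas

/-! ### Words in the generators and their sections. -/

section GrigorchukWords

/- A word is a list of letters: `none` stands for `a`, and `some i` for the directed generator
whose left section is trivial when the current symbol is `i`; that is, `some 2`, `some 1`,
`some 0` stand for `b_ω`, `c_ω`, `d_ω`. -/

/-- The automorphism denoted by a letter. -/
def letterPerm (ω : ℕ → Fin 3) : Option (Fin 3) → Equiv.Perm (List Bool)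
  | none => grigA
  | some i => directedPerm (fun n => decide (ω n ≠ i))

/-- The shift of a sequence of symbols. -/
def shiftSeq (ω : ℕ → Fin 3) : ℕ → Fin 3 := fun n => ω (n + 1)

/-- The automorphism denoted by a word. -/
def wordPerm (ω : ℕ → Fin 3) (w : List (Option (Fin 3))) : Equiv.Perm (List Bool) :=
  (w.map (letterPerm ω)).prod

variable (ω : ℕ → Fin 3)

@[simp] theorem wordPerm_nil : wordPerm ω [] = 1 := rfl

@[simp] theorem wordPerm_cons (l : Option (Fin 3)) (w : List (Option (Fin 3))) :
    wordPerm ω (l :: w) = letterPerm ω l * wordPerm ω w := by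
  simp [wordPerm]

theorem wordPerm_append (v w : List (Option (Fin 3))) :
    wordPerm ω (v ++ w) = wordPerm ω v * wordPerm ω w := by
  simp [wordPerm]

@[simp] theorem letterPerm_mul_self (l : Option (Fin 3)) :
    letterPerm ω l * letterPerm ω l = 1 := by
  ext1 v
  cases l
  · exact rootSwap_involutive v
  · exact directedMap_involutive _ v

theorem letterPerm_inv (l : Option (Fin 3)) : (letterPerm ω l)⁻¹ = letterPerm ω l :=
  inv_eq_of_mul_eq_one_left (letterPerm_mul_self ω l)

theorem wordPerm_reverse (w : List (Option (Fin 3))) :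
    wordPerm ω w.reverse = (wordPerm ω w)⁻¹ := by
  induction w with
  | nil => simp
  | cons l w ih => simp [wordPerm_append, ih, letterPerm_inv]

@[simp] theorem letterPerm_nil (l : Option (Fin 3)) : letterPerm ω l [] = [] := by
  cases l <;> rfl

@[simp] theorem wordPerm_apply_nil (w : List (Option (Fin 3))) : wordPerm ω w [] = [] := by
  induction w with
  | nil => rfl
  | cons l w ih => simp [ih]

@[simp] theorem letterPerm_none_cons (x : Bool) (v : List Bool) :
    letterPerm ω none (x :: v) = (!x) :: v := rfl

@[simp] theorem letterPerm_some_true (i : Fin 3) (v : List Bool) :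
    letterPerm ω (some i) (true :: v) = true :: letterPerm (shiftSeq ω) (some i) v := rfl

theorem letterPerm_some_false_of_eq {i : Fin 3} (h : ω 0 = i) (v : List Bool) :
    letterPerm ω (some i) (false :: v) = false :: v := by
  change false :: (if decide (ω 0 ≠ i) = true then rootSwap v else v) = _
  simp [h]

theorem letterPerm_some_false_of_ne {i : Fin 3} (h : ω 0 ≠ i) (v : List Bool) :
    letterPerm ω (some i) (false :: v) = false :: letterPerm (shiftSeq ω) none v := by
  change false :: (if decide (ω 0 ≠ i) = true then rootSwap v else v) = _
  simp only [ne_eq, h, not_false_eq_true, decide_true, if_true]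
  rfl

/-- The number of letters other than `a` and the letter `z`. -/
def countOther (z : Fin 3) (w : List (Option (Fin 3))) : ℕ :=
  w.countP fun l => decide (l ≠ none ∧ l ≠ some z)

@[simp] theorem countOther_nil (z : Fin 3) : countOther z [] = 0 := rfl

@[simp] theorem countOther_none (z : Fin 3) (w : List (Option (Fin 3))) :
    countOther z (none :: w) = countOther z w := by
  simp [countOther]

theorem countOther_some (z i : Fin 3) (w : List (Option (Fin 3))) :
    countOther z (some i :: w) = countOther z w + if i = z then 0 else 1 := by
  by_cases h : i = z <;> simp [countOther, h]

/-- The level-one decomposition of the automorphism denoted by a word. -/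
theorem exists_sections (w : List (Option (Fin 3))) :
    ∃ (s : Bool) (w₀ w₁ : List (Option (Fin 3))),
      (∀ v, wordPerm ω w (false :: v) = s :: wordPerm (shiftSeq ω) w₀ v) ∧
      (∀ v, wordPerm ω w (true :: v) = (!s) :: wordPerm (shiftSeq ω) w₁ v) ∧
      (∀ z, countOther z w₀ + countOther z w₁ = countOther z w) ∧
      w₀.count none + w₁.count none = countOther (ω 0) w := by
  induction w with
  | nil => exact ⟨false, [], [], by simp, by simp, by simp, by simp⟩
  | cons l w ih =>
    obtain ⟨s, w₀, w₁, h0, h1, hz, ha⟩ := ih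
    cases l with
    | none =>
      exact ⟨!s, w₀, w₁, by simp [h0], by simp [h1], by simpa using hz, by simpa using ha⟩
    | some i =>
      -- The bit `s` records where the rest of the word has sent the two branches. The branch now on
      -- the right receives the letter `i` itself; the one now on the left receives an `a`, or
      -- nothing if `i` is the current symbol.
      by_cases hi : ω 0 = i
      · cases s
        · refine ⟨false, w₀, some i :: w₁, fun v => ?_, fun v => ?_, fun z => ?_, ?_⟩
          · simp [h0, letterPerm_some_false_of_eq ω hi]
          · simp [h1]
          · rw [countOther_some, countOther_some, ← hz]; omega
          · simp [countOther_some, hi, ha]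
        · refine ⟨true, some i :: w₀, w₁, fun v => ?_, fun v => ?_, fun z => ?_, ?_⟩
          · simp [h0]
          · simp [h1, letterPerm_some_false_of_eq ω hi]
          · rw [countOther_some, countOther_some, ← hz]; omega
          · simp [countOther_some, hi, ha]
      · have hi' : i ≠ ω 0 := fun h => hi h.symm
        cases s
        · refine ⟨false, none :: w₀, some i :: w₁, fun v => ?_, fun v => ?_, fun z => ?_, ?_⟩
          · simp [h0, letterPerm_some_false_of_ne ω hi]
          · simp [h1]
          · rw [countOther_some, countOther_some, countOther_none, ← hz]; omega
          · simp [countOther_some, hi', ← ha]; omega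
        · refine ⟨true, some i :: w₀, none :: w₁, fun v => ?_, fun v => ?_, fun z => ?_, ?_⟩
          · simp [h0]
          · simp [h1, letterPerm_some_false_of_ne ω hi]
          · rw [countOther_some, countOther_some, countOther_none, ← hz]; omega
          · simp [countOther_some, hi', ← ha]; omega

theorem directedPerm_mul (p q : ℕ → Bool) :
    directedPerm p * directedPerm q = directedPerm (fun n => xor (p n) (q n)) := by
  ext1 v
  change directedMap p (directedMap q v) = directedMap _ v
  induction v generalizing p q with
  | nil => rfl
  | cons x v ih =>
    cases x
    · cases hp : p 0 <;> cases hq : q 0 <;>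
        simp [directedMap, hp, hq, rootSwap_involutive v]
    · simp [directedMap, ih]

theorem letterPerm_some_mul {i j : Fin 3} (hij : i ≠ j) :
    ∃ k, letterPerm ω (some i) * letterPerm ω (some j) = letterPerm ω (some k) := by
  obtain ⟨k, hk⟩ : ∃ k : Fin 3, ∀ x : Fin 3,
      xor (decide (x ≠ i)) (decide (x ≠ j)) = decide (x ≠ k) := by
    revert i j; decide
  exact ⟨k, by simp only [letterPerm, directedPerm_mul, hk]⟩

/-- A word with `a`s separated by single (possibly trivial) directed letters. -/
def slotWord (us : List (Option (Fin 3))) : List (Option (Fin 3)) :=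
  us.flatMap fun u => none :: (u.map some).toList

@[simp] theorem slotWord_nil : slotWord [] = [] := rfl

@[simp] theorem slotWord_cons (u : Option (Fin 3)) (us : List (Option (Fin 3))) :
    slotWord (u :: us) = none :: ((u.map some).toList ++ slotWord us) := by
  simp [slotWord]

/-- Directed letters multiply as in a Klein four-group, so a block of them between two `a`s
collapses to at most one letter. The extra leading `a` opens a slot for the letters before the first
`a` of `w`. -/
theorem exists_slotWord (w : List (Option (Fin 3))) :
    ∃ us : List (Option (Fin 3)), us.length = w.count none + 1 ∧
      letterPerm ω none * wordPerm ω w = wordPerm ω (slotWord us) := by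
  induction w with
  | nil => exact ⟨[none], by simp⟩
  | cons l w ih =>
    obtain ⟨us, hlen, hus⟩ := ih
    cases l with
    | none => exact ⟨none :: us, by simp [hlen], by simp [hus]⟩
    | some i =>
      cases us with
      | nil => simp at hlen
      | cons u us =>
        have hw : wordPerm ω w = wordPerm ω ((u.map some).toList ++ slotWord us) := by
          simpa using hus
        simp only [List.length_cons, Nat.add_right_cancel_iff] at hlen
        cases u with
        | none => exact ⟨some i :: us, by simp [hlen], by simp [hw]⟩
        | some j =>
          by_cases hij : i = j
          · refine ⟨none :: us, by simp [hlen], ?_⟩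
            subst hij
            simp [hw, ← mul_assoc (letterPerm ω (some i)) (letterPerm ω (some i))]
          · obtain ⟨k, hk⟩ := letterPerm_some_mul ω hij
            refine ⟨some k :: us, by simp [hlen], ?_⟩
            simp [hw, ← hk, mul_assoc]

theorem countOther_slotWord (z : Fin 3) (us : List (Option (Fin 3))) :
    countOther z (slotWord us) = countOther z us := by
  induction us with
  | nil => rfl
  | cons u us ih => cases u <;> simp [countOther_some, ih]

end GrigorchukWords

/-! ### Lifting double commutators to rigid stabilizers. -/

section Lifts

/-- `g` fixes the vertices of level one and acts on the left and right subtrees by `h₀`, `h₁`. -/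
def HasSections (g h₀ h₁ : Equiv.Perm (List Bool)) : Prop :=
  (∀ v, g (false :: v) = false :: h₀ v) ∧ ∀ v, g (true :: v) = true :: h₁ v

theorem HasSections.mul {g h₀ h₁ g' h₀' h₁' : Equiv.Perm (List Bool)} (h : HasSections g h₀ h₁)
    (h' : HasSections g' h₀' h₁') : HasSections (g * g') (h₀ * h₀') (h₁ * h₁') :=
  ⟨fun v => by simp [h.1, h'.1], fun v => by simp [h.2, h'.2]⟩

theorem HasSections.inv {g h₀ h₁ : Equiv.Perm (List Bool)} (h : HasSections g h₀ h₁) :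
    HasSections g⁻¹ h₀⁻¹ h₁⁻¹ :=
  ⟨fun v => by rw [Equiv.Perm.inv_eq_iff_eq, h.1]; simp,
    fun v => by rw [Equiv.Perm.inv_eq_iff_eq, h.2]; simp⟩

theorem HasSections.commutator {g h₀ h₁ g' h₀' h₁' : Equiv.Perm (List Bool)}
    (h : HasSections g h₀ h₁) (h' : HasSections g' h₀' h₁') :
    HasSections ⁅g, g'⁆ ⁅h₀, h₀'⁆ ⁅h₁, h₁'⁆ :=
  ((h.mul h').mul h.inv).mul h'.inv

/-- The group generated by two involutions is metabelian. -/
theorem commutator_commutator_eq_one_of_involutions {G : Type*} [Group G] {α β : G}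
    (hα : α * α = 1) (hβ : β * β = 1) {p q r s : G} (hp : p ∈ Subgroup.closure {α, β})
    (hq : q ∈ Subgroup.closure {α, β}) (hr : r ∈ Subgroup.closure {α, β})
    (hs : s ∈ Subgroup.closure {α, β}) : ⁅⁅p, q⁆, ⁅r, s⁆⁆ = 1 := by
  set ρ := α * β with hρ
  have hα' : α⁻¹ = α := inv_eq_of_mul_eq_one_left hα
  have hβ' : β⁻¹ = β := inv_eq_of_mul_eq_one_left hβ
  have hconj : α * ρ * α⁻¹ = ρ⁻¹ := by rw [hρ, mul_inv_rev, hα', hβ', ← mul_assoc, hα, one_mul]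
  have hz : ∀ k : ℤ, α * ρ ^ k = ρ ^ (-k) * α := by
    intro k
    rw [← mul_inv_eq_iff_eq_mul, ← conj_zpow, hconj, inv_zpow']
  have hβρ : β = ρ ^ (-1 : ℤ) * α := by
    rw [zpow_neg_one, hρ, mul_inv_rev, hα', hβ', mul_assoc, hα, mul_one]
  -- Dihedral normal form: every element is a power of the rotation `ρ`, possibly times `α`.
  -- Commutators are then powers of `ρ`, and these commute.
  have form : ∀ g ∈ Subgroup.closure {α, β}, ∃ k : ℤ, g = ρ ^ k ∨ g = ρ ^ k * α := by
    intro g hg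
    induction hg using Subgroup.closure_induction with
    | mem x hx =>
      rcases hx with rfl | rfl
      · exact ⟨0, Or.inr (by simp)⟩
      · exact ⟨-1, Or.inr hβρ⟩
    | one => exact ⟨0, Or.inl (by simp)⟩
    | mul x y _ _ hx hy =>
      obtain ⟨k, rfl | rfl⟩ := hx <;> obtain ⟨l, rfl | rfl⟩ := hy
      · exact ⟨k + l, Or.inl (zpow_add _ _ _).symm⟩
      · exact ⟨k + l, Or.inr (by rw [zpow_add, mul_assoc])⟩
      · exact ⟨k - l, Or.inr (by rw [mul_assoc, hz, ← mul_assoc, ← zpow_add, sub_eq_add_neg])⟩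
      · refine ⟨k - l, Or.inl ?_⟩
        rw [mul_assoc, ← mul_assoc α, hz, mul_assoc, hα, mul_one, ← zpow_add, sub_eq_add_neg]
    | inv x _ hx =>
      obtain ⟨k, rfl | rfl⟩ := hx
      · exact ⟨-k, Or.inl (zpow_neg _ _).symm⟩
      · exact ⟨k, Or.inr (by rw [mul_inv_rev, hα', ← zpow_neg, hz, neg_neg])⟩
  have rot : ∀ g ∈ Subgroup.closure {α, β}, ∀ h ∈ Subgroup.closure {α, β},
      ∃ k : ℤ, ⁅g, h⁆ = ρ ^ k := by
    intro g hg h hh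
    obtain ⟨k, rfl | rfl⟩ := form g hg <;> obtain ⟨l, rfl | rfl⟩ := form h hh
    · exact ⟨0, by
        rw [zpow_zero, commutatorElement_eq_one_iff_mul_comm, ← zpow_add, ← zpow_add, add_comm]⟩
    · refine ⟨k + l + k - l, ?_⟩
      rw [commutatorElement_def, mul_inv_rev, hα', ← zpow_neg, ← zpow_neg]
      simp only [mul_assoc, hz]
      simp only [← mul_assoc, ← zpow_add]
      simp only [mul_assoc, hz, hα, mul_one, ← zpow_add]
      congr 1; ring
    · refine ⟨k - l - k - l, ?_⟩
      rw [commutatorElement_def, mul_inv_rev, hα', ← zpow_neg, ← zpow_neg]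
      simp only [mul_assoc, hz]
      simp only [← mul_assoc, ← zpow_add]
      simp only [mul_assoc, hz, hα, mul_one, ← zpow_add]
      congr 1; ring
    · refine ⟨2 * k - 2 * l, ?_⟩
      rw [commutatorElement_def, mul_inv_rev, mul_inv_rev, hα', ← zpow_neg, ← zpow_neg]
      simp only [mul_assoc, hz]
      simp only [← mul_assoc]
      simp only [mul_assoc, hz, hα, mul_one, ← zpow_add]
      congr 1; ring
  obtain ⟨k, hk⟩ := rot p hp q hq
  obtain ⟨l, hl⟩ := rot r hr s hs
  rw [hk, hl, commutatorElement_eq_one_iff_mul_comm, ← zpow_add, ← zpow_add, add_comm]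

/-- The substitution `a ↦ a y a`, fixing the directed letters. -/
def liftWord (y : Fin 3) (w : List (Option (Fin 3))) : List (Option (Fin 3)) :=
  w.flatMap fun l => l.casesOn [none, some y, none] fun i => [some i]

@[simp] theorem liftWord_nil (y : Fin 3) : liftWord y [] = [] := rfl

@[simp] theorem liftWord_none (y : Fin 3) (w : List (Option (Fin 3))) :
    liftWord y (none :: w) = none :: some y :: none :: liftWord y w := by
  simp [liftWord]

@[simp] theorem liftWord_some (y i : Fin 3) (w : List (Option (Fin 3))) :
    liftWord y (some i :: w) = some i :: liftWord y w := by
  simp [liftWord]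

theorem count_liftWord (y : Fin 3) (w : List (Option (Fin 3))) :
    (liftWord y w).count none = 2 * w.count none := by
  induction w with
  | nil => simp
  | cons l w ih => cases l <;> simp [ih]; omega

theorem length_liftWord (y : Fin 3) (w : List (Option (Fin 3))) :
    (liftWord y w).length = w.length + 2 * w.count none := by
  induction w with
  | nil => simp
  | cons l w ih => cases l <;> simp [ih] <;> omega

variable (ω : ℕ → Fin 3)

/-- Since `y` differs from the current symbol, y = (a, y') and a y a = (y', a). On the right, `a` is
therefore reproduced and directed letters shift. On the left only `a` and `y'` occur, and they
generate a dihedral group. -/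
theorem wordPerm_liftWord {y : Fin 3} (hy : ω 0 ≠ y) (w : List (Option (Fin 3))) :
    ∃ h ∈ Subgroup.closure {letterPerm (shiftSeq ω) none, letterPerm (shiftSeq ω) (some y)},
      HasSections (wordPerm ω (liftWord y w)) h (wordPerm (shiftSeq ω) w) := by
  induction w with
  | nil => exact ⟨1, one_mem _, fun v => by simp, fun v => by simp⟩
  | cons l w ih =>
    obtain ⟨h, hmem, hs⟩ := ih
    cases l with
    | none =>
      refine ⟨letterPerm (shiftSeq ω) (some y) * h,
        mul_mem (Subgroup.subset_closure (by simp)) hmem, fun v => ?_, fun v => ?_⟩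
      · simp [hs.1]
      · simp [hs.2, letterPerm_some_false_of_ne ω hy]
    | some i =>
      by_cases hi : ω 0 = i
      · refine ⟨h, hmem, fun v => ?_, fun v => ?_⟩
        · simp [hs.1, letterPerm_some_false_of_eq ω hi]
        · simp [hs.2]
      · refine ⟨letterPerm (shiftSeq ω) none * h,
          mul_mem (Subgroup.subset_closure (by simp)) hmem, fun v => ?_, fun v => ?_⟩
        · simp [hs.1, letterPerm_some_false_of_ne ω hi]
        · simp [hs.2]

/-- A word for the double commutator `[[p, q], [r, s]]`. -/
def doubleCommWord (p q r s : List (Option (Fin 3))) : List (Option (Fin 3)) :=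
  let c := p ++ q ++ p.reverse ++ q.reverse
  let d := r ++ s ++ r.reverse ++ s.reverse
  c ++ d ++ c.reverse ++ d.reverse

theorem wordPerm_doubleCommWord (p q r s : List (Option (Fin 3))) :
    wordPerm ω (doubleCommWord p q r s) =
      ⁅⁅wordPerm ω p, wordPerm ω q⁆, ⁅wordPerm ω r, wordPerm ω s⁆⁆ := by
  simp only [doubleCommWord, wordPerm_append, wordPerm_reverse, commutatorElement_def]

theorem length_doubleCommWord (p q r s : List (Option (Fin 3))) :
    (doubleCommWord p q r s).length = 4 * (p.length + q.length + r.length + s.length) := by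
  simp [doubleCommWord]; omega

/-- The left section is a double commutator in a metabelian group, so it vanishes. -/
theorem hasSections_liftWord_doubleCommWord {y : Fin 3} (hy : ω 0 ≠ y)
    (p q r s : List (Option (Fin 3))) :
    HasSections (wordPerm ω (doubleCommWord (liftWord y p) (liftWord y q) (liftWord y r)
      (liftWord y s))) 1 (wordPerm (shiftSeq ω) (doubleCommWord p q r s)) := by
  obtain ⟨h₁, m₁, hs₁⟩ := wordPerm_liftWord ω hy p
  obtain ⟨h₂, m₂, hs₂⟩ := wordPerm_liftWord ω hy q
  obtain ⟨h₃, m₃, hs₃⟩ := wordPerm_liftWord ω hy r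
  obtain ⟨h₄, m₄, hs₄⟩ := wordPerm_liftWord ω hy s
  rw [wordPerm_doubleCommWord, wordPerm_doubleCommWord,
    ← commutator_commutator_eq_one_of_involutions (letterPerm_mul_self _ _)
      (letterPerm_mul_self _ _) m₁ m₂ m₃ m₄]
  exact (hs₁.commutator hs₂).commutator (hs₃.commutator hs₄)

/-- The sequence shifted `k` times. -/
def shiftSeqIter (k : ℕ) : ℕ → Fin 3 := fun n => ω (n + k)

theorem shiftSeqIter_succ (k : ℕ) : shiftSeqIter ω (k + 1) = shiftSeqIter (shiftSeq ω) k := by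
  funext n
  simp only [shiftSeqIter, shiftSeq]
  congr 1

theorem exists_ne_symbol (i : Fin 3) : ∃ y : Fin 3, i ≠ y := by
  revert i; decide

/-- Double commutators lift to elements of the rigid stabilizer of the vertex `1 ^ k`. -/
theorem exists_rigid_word (k : ℕ) (p q r s : List (Option (Fin 3)))
    (hp : p.length ≤ 1) (hq : q.length ≤ 1) (hr : r.length ≤ 1) (hs : s.length ≤ 1) :
    ∃ t : List (Option (Fin 3)), t.length ≤ 48 * 2 ^ k ∧
      (∀ v, wordPerm ω t (List.replicate k true ++ v) =
        List.replicate k true ++ wordPerm (shiftSeqIter ω k) (doubleCommWord p q r s) v) ∧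
      ∀ v, ¬ List.replicate k true <+: v → wordPerm ω t v = v := by
  -- Lifting adds two letters for each `a` and doubles the number of `a`s, so both quantities are
  -- carried through the induction. The double commutator has 16 blocks of length at most 3 · 2^k,
  -- whence 48.
  suffices H : ∃ P Q R S : List (Option (Fin 3)),
      (∀ W ∈ [P, Q, R, S], W.count none ≤ 2 ^ k ∧ W.length + 2 ≤ 3 * 2 ^ k) ∧
      (∀ v, wordPerm ω (doubleCommWord P Q R S) (List.replicate k true ++ v) =
        List.replicate k true ++ wordPerm (shiftSeqIter ω k) (doubleCommWord p q r s) v) ∧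
      ∀ v, ¬ List.replicate k true <+: v → wordPerm ω (doubleCommWord P Q R S) v = v by
    obtain ⟨P, Q, R, S, hlen, h1, h2⟩ := H
    refine ⟨_, ?_, h1, h2⟩
    rw [length_doubleCommWord]
    simp only [List.mem_cons, List.not_mem_nil, or_false, forall_eq_or_imp, forall_eq] at hlen
    omega
  induction k generalizing ω with
  | zero =>
    refine ⟨p, q, r, s, ?_, fun v => rfl, fun v hv => absurd (by simp) hv⟩
    simp only [List.mem_cons, List.not_mem_nil, or_false, forall_eq_or_imp, forall_eq]
    have h : ∀ W : List (Option (Fin 3)), W.length ≤ 1 →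
        W.count none ≤ 2 ^ 0 ∧ W.length + 2 ≤ 3 * 2 ^ 0 := fun W hW =>
      ⟨List.count_le_length.trans (by simpa using hW), by omega⟩
    exact ⟨h p hp, h q hq, h r hr, h s hs⟩
  | succ k ih =>
    obtain ⟨P, Q, R, S, hlen, h1, h2⟩ := ih (shiftSeq ω)
    obtain ⟨y, hy⟩ := exists_ne_symbol (ω 0)
    have hsec := hasSections_liftWord_doubleCommWord ω hy P Q R S
    refine ⟨liftWord y P, liftWord y Q, liftWord y R, liftWord y S, ?_, fun v => ?_, fun v hv => ?_⟩
    · have h : ∀ W : List (Option (Fin 3)),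
          (W.count none ≤ 2 ^ k ∧ W.length + 2 ≤ 3 * 2 ^ k) →
          ((liftWord y W).count none ≤ 2 ^ (k + 1) ∧
            (liftWord y W).length + 2 ≤ 3 * 2 ^ (k + 1)) := by
        intro W hW
        rw [count_liftWord, length_liftWord, pow_succ]
        omega
      simp only [List.mem_cons, List.not_mem_nil, or_false, forall_eq_or_imp, forall_eq] at hlen ⊢
      exact ⟨h _ hlen.1, h _ hlen.2.1, h _ hlen.2.2.1, h _ hlen.2.2.2⟩
    · rw [List.replicate_succ, List.cons_append, hsec.2, h1, shiftSeqIter_succ, List.cons_append]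
    · match v with
      | [] => simp
      | false :: v => rw [hsec.1]; rfl
      | true :: v =>
        rw [hsec.2, h2]
        rwa [List.replicate_succ, List.cons_prefix_cons, and_iff_right rfl] at hv

/-- Every vertex of level `k` is reached from `1 ^ k` by a short word that acts on the subtree at
`1 ^ k` as a translation. -/
theorem exists_translation_word (u : List Bool) :
    ∃ w : List (Option (Fin 3)), w.length ≤ 2 * 2 ^ u.length ∧
      ∀ v, wordPerm ω w (List.replicate u.length true ++ v) = u ++ v := by
  -- The `+ 1` leaves room for the `a` put in front when the first letter of the vertex is `false`.
  suffices H : ∃ w : List (Option (Fin 3)), w.count none + 1 ≤ 2 ^ u.length ∧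
      w.length ≤ 2 * 2 ^ u.length ∧
      ∀ v, wordPerm ω w (List.replicate u.length true ++ v) = u ++ v by
    obtain ⟨w, -, h⟩ := H
    exact ⟨w, h⟩
  induction u generalizing ω with
  | nil => exact ⟨[], by simp⟩
  | cons x u ih =>
    obtain ⟨w, hc, hl, hw⟩ := ih (shiftSeq ω)
    obtain ⟨y, hy⟩ := exists_ne_symbol (ω 0)
    obtain ⟨h, -, hsec⟩ := wordPerm_liftWord ω hy w
    cases x with
    | true =>
      refine ⟨liftWord y w, ?_, ?_, fun v => ?_⟩
      · rw [count_liftWord, List.length_cons, pow_succ]; omega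
      · rw [length_liftWord, List.length_cons, pow_succ]; omega
      · rw [List.length_cons, List.replicate_succ, List.cons_append, hsec.2, hw, List.cons_append]
    | false =>
      refine ⟨none :: liftWord y w, ?_, ?_, fun v => ?_⟩
      · rw [List.count_cons_self, count_liftWord, List.length_cons, pow_succ]; omega
      · rw [List.length_cons, length_liftWord, List.length_cons, pow_succ]; omega
      · rw [List.length_cons, List.replicate_succ, List.cons_append, wordPerm_cons,
          Equiv.Perm.mul_apply, hsec.2, hw, letterPerm_none_cons, List.cons_append]
        rfl

end Lifts

/-! ### Exponential lower bound for the Følner function. -/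

section LowerBound

theorem directedPerm_ne_one {p : ℕ → Bool} {j : ℕ} (hj : p j = true) : directedPerm p ≠ 1 := by
  suffices H : directedMap p (List.replicate j true ++ [false, false]) ≠
      List.replicate j true ++ [false, false] from fun h => H (DFunLike.congr_fun h _)
  induction j generalizing p with
  | zero => simp [directedMap, hj, rootSwap]
  | succ j ih =>
    rw [List.replicate_succ, List.cons_append]
    intro h
    exact ih (p := fun n => p (n + 1)) hj (List.cons_injective h)

theorem not_eventuallyConst_shiftSeq {ω : ℕ → Fin 3} (hω : ¬ EventuallyConst ω atTop) :
    ¬ EventuallyConst (shiftSeq ω) atTop := by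
  intro h
  obtain ⟨N, hN⟩ := eventuallyConst_atTop.1 h
  refine hω (eventuallyConst_atTop.2 ⟨N + 1, fun j hj => ?_⟩)
  obtain ⟨i, rfl⟩ := Nat.exists_eq_add_of_le' (show 1 ≤ j by omega)
  exact hN i (by omega)

theorem not_eventuallyConst_shiftSeqIter {ω : ℕ → Fin 3} (hω : ¬ EventuallyConst ω atTop)
    (k : ℕ) : ¬ EventuallyConst (shiftSeqIter ω k) atTop := by
  induction k generalizing ω with
  | zero => exact hω
  | succ k ih =>
    rw [shiftSeqIter_succ]
    exact ih (not_eventuallyConst_shiftSeq hω)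

theorem exists_ne_of_not_eventuallyConst {ω : ℕ → Fin 3} (hω : ¬ EventuallyConst ω atTop)
    (i : Fin 3) : ∃ n, ω n ≠ i := by
  by_contra! h
  exact hω (eventuallyConst_atTop.2 ⟨0, fun j _ => by rw [h, h]⟩)

theorem letterPerm_some_ne_one {ω : ℕ → Fin 3} (hω : ¬ EventuallyConst ω atTop) (i : Fin 3) :
    letterPerm ω (some i) ≠ 1 := by
  obtain ⟨n, hn⟩ := exists_ne_of_not_eventuallyConst hω i
  exact directedPerm_ne_one (j := n) (by simpa using hn)

theorem letterPerm_some_comm (ω : ℕ → Fin 3) (i j : Fin 3) :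
    letterPerm ω (some i) * letterPerm ω (some j) =
      letterPerm ω (some j) * letterPerm ω (some i) := by
  simp only [letterPerm, directedPerm_mul, Bool.xor_comm]

theorem letterPerm_some_mul_none_ne {ω : ℕ → Fin 3} (hω : ¬ EventuallyConst ω atTop) (i : Fin 3) :
    ∃ v, letterPerm ω (some i) (letterPerm ω none v) ≠
      letterPerm ω none (letterPerm ω (some i) v) := by
  by_contra! h
  by_cases hi : ω 0 = i
  · refine letterPerm_some_ne_one (not_eventuallyConst_shiftSeq hω) i (Equiv.ext fun v => ?_)
    simpa [letterPerm_some_false_of_eq ω hi] using h (false :: v)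
  · simpa [letterPerm_some_false_of_ne ω hi] using h [false, true]

/-- Let x = (1, x') be the letter of the current symbol and y = (a, y') another one. Then [a, x] =
(x', x') and [a, y] = (y'a, ay'). If these commuted, then, as x' and y' commute, x' would commute
with a. -/
theorem exists_doubleCommWord_ne {ω : ℕ → Fin 3} (hω : ¬ EventuallyConst ω atTop) :
    ∃ (i j : Fin 3) (v : List Bool),
      wordPerm ω (doubleCommWord [none] [some i] [none] [some j]) v ≠ v := by
  obtain ⟨j, hj⟩ := exists_ne_symbol (ω 0)
  refine ⟨ω 0, j, ?_⟩
  by_contra! h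
  have h1 : wordPerm ω (doubleCommWord [none] [some (ω 0)] [none] [some j]) = 1 :=
    Equiv.ext fun v => h v
  rw [wordPerm_doubleCommWord, commutatorElement_eq_one_iff_mul_comm] at h1
  obtain ⟨v, hv⟩ := letterPerm_some_mul_none_ne (not_eventuallyConst_shiftSeq hω) (ω 0)
  have h2 := DFunLike.congr_fun h1 (false :: v)
  simp only [commutatorElement_def, wordPerm_cons, wordPerm_nil, mul_one, letterPerm_inv,
    Equiv.Perm.mul_apply, letterPerm_some_false_of_eq ω rfl, letterPerm_some_false_of_ne ω hj,
    letterPerm_none_cons, letterPerm_some_true, Bool.not_false, Bool.not_true] at h2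
  have h3 := List.cons_injective h2
  rw [← Equiv.Perm.mul_apply, letterPerm_some_comm, Equiv.Perm.mul_apply] at h3
  exact hv ((letterPerm _ _).injective h3)

variable (ω : ℕ → Fin 3)

theorem letterPerm_mem (l : Option (Fin 3)) :
    letterPerm ω l ∈ ({grigA, grigB ω, grigC ω, grigD ω} : Set (Equiv.Perm (List Bool))) := by
  match l with
  | none => exact Or.inl rfl
  | some 0 => exact Or.inr (Or.inr (Or.inr rfl))
  | some 1 => exact Or.inr (Or.inr (Or.inl rfl))
  | some 2 => exact Or.inr (Or.inl rfl)

theorem exists_letterPerm_eq {g : Equiv.Perm (List Bool)}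
    (hg : g ∈ ({grigA, grigB ω, grigC ω, grigD ω} : Set (Equiv.Perm (List Bool)))) :
    ∃ l, g = letterPerm ω l := by
  rcases hg with rfl | rfl | rfl | rfl
  exacts [⟨none, rfl⟩, ⟨some 2, rfl⟩, ⟨some 1, rfl⟩, ⟨some 0, rfl⟩]

/-- A letter as an element of the Grigorchuk group. -/
def letterElt (l : Option (Fin 3)) : grigorchukGroup ω :=
  ⟨letterPerm ω l, Subgroup.subset_closure (letterPerm_mem ω l)⟩

theorem letterElt_mem (l : Option (Fin 3)) : letterElt ω l ∈ grigorchukGens ω :=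
  letterPerm_mem ω l

theorem coe_prod_letterElt (w : List (Option (Fin 3))) :
    ((w.map (letterElt ω)).prod : Equiv.Perm (List Bool)) = wordPerm ω w := by
  induction w with
  | nil => rfl
  | cons l w ih =>
    rw [List.map_cons, List.prod_cons, Subgroup.coe_mul, ih, wordPerm_cons]
    rfl

theorem finite_grigorchukGens : (grigorchukGens ω).Finite :=
  Set.Finite.preimage Subtype.val_injective.injOn (by simp)

instance : MulAction (grigorchukGroup ω) (List Bool) where
  smul g v := (g : Equiv.Perm (List Bool)) v
  one_smul _ := rfl
  mul_smul _ _ _ := rfl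

theorem prod_letterElt_smul (w : List (Option (Fin 3))) (v : List Bool) :
    (w.map (letterElt ω)).prod • v = wordPerm ω w v := by
  rw [← coe_prod_letterElt]; rfl

/-- At level `k` there are `2 ^ k` short words moving `2 ^ k` vertices independently. -/
theorem exists_independent_words {ω : ℕ → Fin 3} (hω : ¬ EventuallyConst ω atTop) (k : ℕ) :
    ∃ (t : List.Vector Bool k → List (Option (Fin 3))) (u : List.Vector Bool k → List Bool),
      (∀ i, (t i).length ≤ 52 * 2 ^ k) ∧ (∀ i, wordPerm ω (t i) (u i) ≠ u i) ∧
      ∀ i j, i ≠ j → wordPerm ω (t i) (u j) = u j := by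
  obtain ⟨i, j, z, hz⟩ := exists_doubleCommWord_ne (not_eventuallyConst_shiftSeqIter hω k)
  obtain ⟨r, hr, hr1, hr2⟩ := exists_rigid_word ω k [none] [some i] [none] [some j]
    (by simp) (by simp) (by simp) (by simp)
  have hw := fun x : List.Vector Bool k => exists_translation_word ω x.toList
  simp only [List.Vector.toList_length] at hw
  choose w hwl hw using hw
  -- Conjugating by the translation word carries the support from below 1^k to below `x`, and the
  -- subtrees at distinct vertices of one level are disjoint. The length is at most (48 + 2 · 2) ·
  -- 2^k.
  refine ⟨fun x => w x ++ r ++ (w x).reverse, fun x => x.toList ++ z, fun x => ?_, fun x => ?_,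
    fun x y hxy => ?_⟩
  · have := hwl x
    simp only [List.length_append, List.length_reverse]
    omega
  · have hinv : (wordPerm ω (w x))⁻¹ (x.toList ++ z) = List.replicate k true ++ z := by
      rw [Equiv.Perm.inv_eq_iff_eq, hw]
    simp only [wordPerm_append, wordPerm_reverse, Equiv.Perm.mul_apply, hinv, hr1, hw]
    intro h
    exact hz (List.append_cancel_left h)
  · simp only [wordPerm_append, wordPerm_reverse, Equiv.Perm.mul_apply]
    rw [hr2]
    · simp
    · rintro ⟨s, hs⟩
      rw [Equiv.Perm.eq_inv_iff_eq, hw] at hs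
      have := List.append_inj_left hs (by simp)
      exact hxy (Subtype.ext this)

theorem one_lt_card_of_boundary_le_half {G : Type*} [Group G] {S : Set G} {x : G} (hx : x ∈ S)
    (hx1 : x ≠ 1) {n : ℕ} (hn : 2 ≤ n) {V : Finset G} (hV : V.Nonempty)
    (hb : n * (folnerBoundary S (V : Set G)).ncard ≤ V.card) : 1 < V.card := by
  by_contra! h
  obtain ⟨v, rfl⟩ := Finset.card_eq_one.1 (le_antisymm h hV.card_pos)
  have hmem : v ∈ folnerBoundary S (({v} : Finset G) : Set G) :=
    mem_folnerBoundary (x := x) (by simp) hx (by simpa using hx1)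
  have : 0 < (folnerBoundary S (({v} : Finset G) : Set G)).ncard :=
    (Set.ncard_pos ((Finset.finite_toSet _).subset (folnerBoundary_subset _ _))).2 ⟨v, hmem⟩
  rw [Finset.card_singleton] at hb
  nlinarith

theorem two_pow_le_card_grigorchuk {ω : ℕ → Fin 3} (hω : ¬ EventuallyConst ω atTop) {n : ℕ}
    (hn : 2 ≤ n) (V : Finset (grigorchukGroup ω)) (hV : V.Nonempty)
    (hb : n * (folnerBoundary (grigorchukGens ω) (V : Set (grigorchukGroup ω))).ncard ≤ V.card) :
    (2 : ℝ) ^ ((1 / 1024 : ℝ) * n) ≤ V.card := by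
  classical
  suffices H : ∃ d : ℕ, 2 ^ d ≤ V.card ∧ n ≤ 1024 * d by
    obtain ⟨d, hd, hnd⟩ := H
    have h1 : (n : ℝ) ≤ 1024 * d := by exact_mod_cast hnd
    calc (2 : ℝ) ^ ((1 / 1024 : ℝ) * n) ≤ (2 : ℝ) ^ (d : ℝ) :=
          Real.rpow_le_rpow_of_exponent_le (by norm_num) (by linarith)
      _ = ((2 ^ d : ℕ) : ℝ) := by rw [Real.rpow_natCast]; norm_cast
      _ ≤ V.card := by exact_mod_cast hd
  -- For small `n` it is enough that `V` is not a singleton. Otherwise use a level l with 128 · 2^l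
  -- ≤ n < 256 · 2^l, so that 2 · 52 · 2^l ≤ n, and d = 2^l / 4, so that n < 1024 d.
  by_cases hn1 : n ≤ 1024
  · refine ⟨1, ?_, by omega⟩
    refine one_lt_card_of_boundary_le_half (letterElt_mem ω none) ?_ hn hV hb
    intro h
    have := DFunLike.congr_fun (congrArg Subtype.val h) [false]
    simp [letterElt] at this
  · obtain ⟨k, hk1, hk2⟩ := exists_nat_pow_near (x := n / 128) (y := 2) (by omega) (by norm_num)
    have hk0 : k ≠ 0 := by
      rintro rfl
      omega
    obtain ⟨k, rfl⟩ := Nat.exists_eq_succ_of_ne_zero hk0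
    rw [Nat.succ_eq_add_one] at *
    have hk3 : 4 ≤ 2 ^ (k + 1) := by
      rw [pow_succ] at hk2
      omega
    have hk4 : 1 ≤ k := by
      by_contra! hc
      interval_cases k
      omega
    obtain ⟨k, rfl⟩ := Nat.exists_eq_add_of_le' hk4
    obtain ⟨t, u, hl, h1, h2⟩ := exists_independent_words hω (k + 1 + 1)
    refine ⟨2 ^ k, ?_, by
      simp only [pow_succ] at hk2
      omega⟩
    refine two_pow_le_card_of_boundary (t := fun i => (t i).map (letterElt ω)) (u := u) (n := n)
      ?_ ?_ ?_ ?_ (2 ^ k) ?_ V hV hb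
    · intro i x hx
      obtain ⟨l, -, rfl⟩ := List.mem_map.1 hx
      exact letterElt_mem ω l
    · intro i
      have := hl i
      simp only [pow_succ] at this hk1
      rw [List.length_map]
      omega
    · intro i
      rw [prod_letterElt_smul]
      exact h1 i
    · intro i j hij
      rw [prod_letterElt_smul]
      exact h2 i j hij
    · rw [card_vector, Fintype.card_bool]
      simp only [pow_succ]
      omega

theorem two_pow_le_folnerFunction {ω : ℕ → Fin 3} (hω : ¬ EventuallyConst ω atTop) {n : ℕ}
    (hn : 2 ≤ n) (hex : ∃ V : Finset (grigorchukGroup ω), V.Nonempty ∧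
      ((folnerBoundary (grigorchukGens ω) (V : Set (grigorchukGroup ω))).ncard : ℝ) /
        (V.card : ℝ) ≤ 1 / (n : ℝ)) :
    (2 : ℝ) ^ ((1 / 1024 : ℝ) * n) ≤ folnerFunction (grigorchukGens ω) n := by
  obtain ⟨V, hV, hb⟩ := hex
  -- The existence hypothesis rules out the junk value 0 of the infimum, so the minimum is attained.
  obtain ⟨W, hW, hbW, hcard⟩ := Nat.sInf_mem (s := {m : ℕ | ∃ V : Finset (grigorchukGroup ω),
    V.Nonempty ∧ ((folnerBoundary (grigorchukGens ω) (V : Set (grigorchukGroup ω))).ncard : ℝ) /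
      (V.card : ℝ) ≤ 1 / (n : ℝ) ∧ V.card = m}) ⟨_, V, hV, hb, rfl⟩
  have hpos : (0 : ℝ) < W.card := by exact_mod_cast hW.card_pos
  have hn0 : (0 : ℝ) < n := by exact_mod_cast (show 0 < n by omega)
  rw [div_le_div_iff₀ hpos hn0, one_mul, mul_comm] at hbW
  have h := two_pow_le_card_grigorchuk hω hn W hW (by exact_mod_cast hbW)
  rwa [hcard] at h

end LowerBound

/-! ### Exponential growth rates of families of finite sets. -/

section GrowthRate

variable {X Y : Type*}

/-- The sets `E n` are finite, and their exponential growth rate is at most `r`. -/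
def RateLE (E : ℕ → Set X) (r : ℝ) : Prop :=
  ∀ c, r < c → ∃ K : ℝ, ∀ n, (E n).Finite ∧ ((E n).ncard : ℝ) ≤ K * c ^ n

theorem exists_mul_pow_le {r c : ℝ} (hr : 0 < r) (hc : r < c) :
    ∃ K : ℝ, 0 ≤ K ∧ ∀ n : ℕ, ((n : ℝ) + 1) * r ^ n ≤ K * c ^ n := by
  set x := c / r with hx
  have hx1 : 0 < x - 1 := by rw [hx, sub_pos, one_lt_div hr]; exact hc
  refine ⟨1 + 1 / (x - 1), by positivity, fun n => ?_⟩
  have hcx : c = x * r := by rw [hx, div_mul_cancel₀ _ hr.ne']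
  rw [hcx, mul_pow, ← mul_assoc]
  refine mul_le_mul_of_nonneg_right ?_ (by positivity)
  have h1 := one_add_mul_le_pow (a := x - 1) (by linarith) n
  rw [add_sub_cancel] at h1
  refine le_trans ?_ (mul_le_mul_of_nonneg_left h1 (by positivity))
  have h2 : 1 / (x - 1) * (n * (x - 1)) = n := by field_simp
  have h3 : 0 ≤ 1 / (x - 1) := by positivity
  have h4 : 0 ≤ (n : ℝ) * (x - 1) := by positivity
  linarith [mul_add (1 / (x - 1)) 1 ((n : ℝ) * (x - 1))]

/-- A linear factor is absorbed by passing to a slightly larger base, because the rate only concerns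
bases strictly above `r`. -/
theorem rateLE_of_linear_mul {E : ℕ → Set X} {r : ℝ} (hr : 0 < r)
    (h : ∀ c, r < c → ∃ K : ℝ, ∀ n : ℕ,
      (E n).Finite ∧ ((E n).ncard : ℝ) ≤ K * (((n : ℝ) + 1) * c ^ n)) : RateLE E r := by
  intro c hc
  obtain ⟨c', hc1, hc2⟩ := exists_between hc
  obtain ⟨K, hK⟩ := h c' hc1
  obtain ⟨L, -, hL⟩ := exists_mul_pow_le (hr.trans hc1) hc2
  have hK0 : 0 ≤ K := by
    have := (Nat.cast_nonneg _).trans (hK 0).2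
    simpa using this
  refine ⟨K * L, fun n => ⟨(hK n).1, (hK n).2.trans ?_⟩⟩
  rw [mul_assoc]
  exact mul_le_mul_of_nonneg_left (hL n) hK0

theorem RateLE.const_nonneg {E : ℕ → Set X} {K c : ℝ}
    (hK : ∀ n, (E n).Finite ∧ ((E n).ncard : ℝ) ≤ K * c ^ n) : 0 ≤ K := by
  have := (Nat.cast_nonneg _).trans (hK 0).2
  simpa using this

theorem finite_and_ncard_le {E : Set X} {F : Finset X} (h : E ⊆ F) {B : ℝ} (hB : (F.card : ℝ) ≤ B) :
    E.Finite ∧ (E.ncard : ℝ) ≤ B := by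
  refine ⟨F.finite_toSet.subset h, le_trans ?_ hB⟩
  have := Set.ncard_le_ncard h F.finite_toSet
  rw [Set.ncard_coe_finset] at this
  exact_mod_cast this

/-- A family whose members are assembled from pairs of members of total index `n` has no larger
growth rate. -/
theorem RateLE.of_pairs {E : ℕ → Set X} {E' : ℕ → Set Y} {r : ℝ} (hr : 1 ≤ r) (hE' : RateLE E' r)
    (f : Bool → Y → Y → X)
    (h : ∀ n, ∀ x ∈ E n, ∃ s i j, i + j = n ∧ ∃ y ∈ E' i, ∃ z ∈ E' j, f s y z = x) :
    RateLE E r := by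
  classical
  refine rateLE_of_linear_mul (by linarith) fun c hc => ?_
  obtain ⟨K, hK⟩ := hE' c hc
  have hK0 := RateLE.const_nonneg hK
  have hcard : ∀ n, ((hK n).1.toFinset.card : ℝ) ≤ K * c ^ n := fun n => by
    rw [← Set.ncard_eq_toFinset_card _ (hK n).1]; exact (hK n).2
  refine ⟨2 * K * K, fun n => ?_⟩
  refine finite_and_ncard_le (F := (Finset.range (n + 1)).biUnion fun i =>
    ((Finset.univ : Finset Bool) ×ˢ ((hK i).1.toFinset ×ˢ (hK (n - i)).1.toFinset)).image
      fun p => f p.1 p.2.1 p.2.2) ?_ ?_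
  · intro x hx
    obtain ⟨s, i, j, rfl, y, hy, z, hz, rfl⟩ := h n x hx
    simp only [Finset.coe_biUnion, Set.mem_iUnion, Finset.coe_image, Set.mem_image]
    refine ⟨i, by simp, (s, y, z), ?_, rfl⟩
    simp [hy, hz]
  · refine le_trans (Nat.cast_le.2 (Finset.card_biUnion_le_card_mul _ _ ?_ fun i hi =>
      Finset.card_image_le.trans ?_)) ?_
    · exact ⌊2 * K * K * c ^ n⌋₊
    · refine Nat.le_floor ?_
      rw [Finset.card_product, Finset.card_product, Finset.card_univ, Fintype.card_bool]
      push_cast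
      rw [Finset.mem_range] at hi
      -- Each of the n + 1 splittings contributes at most 2 K² c^n, whatever the value of `i`.
      have hpow : c ^ n = c ^ i * c ^ (n - i) := by rw [← pow_add]; congr 1; omega
      rw [hpow]
      have h0 : (0 : ℝ) ≤ c ^ i := pow_nonneg (by linarith) _
      have := mul_le_mul (hcard i) (hcard (n - i)) (Nat.cast_nonneg _) (mul_nonneg hK0 h0)
      linarith
    · rw [Finset.card_range]
      push_cast
      have := Nat.floor_le (a := 2 * K * K * c ^ n)
        (mul_nonneg (by positivity) (pow_nonneg (by linarith) _))
      have h1 : (0 : ℝ) ≤ n + 1 := by positivity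
      linarith [mul_le_mul_of_nonneg_left this h1]

theorem card_biUnion_range_le [DecidableEq X] {E : ℕ → Set X} {K c : ℝ} (hc : 1 ≤ c)
    (hK : ∀ n, (E n).Finite ∧ ((E n).ncard : ℝ) ≤ K * c ^ n) (J : ℕ) :
    (((Finset.range (J + 1)).biUnion fun i => (hK i).1.toFinset).card : ℝ) ≤
      K * ((J + 1) * c ^ J) := by
  have hK0 := RateLE.const_nonneg hK
  refine le_trans (Nat.cast_le.2 Finset.card_biUnion_le) ?_
  push_cast
  refine (Finset.sum_le_card_nsmul _ _ (K * c ^ J) fun i hi => ?_).trans ?_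
  · rw [← Set.ncard_eq_toFinset_card _ (hK i).1]
    refine (hK i).2.trans (mul_le_mul_of_nonneg_left (pow_le_pow_right₀ hc ?_) hK0)
    rw [Finset.mem_range] at hi
    omega
  · rw [Finset.card_range, nsmul_eq_mul]
    push_cast
    linarith

end GrowthRate

/-! ### Subexponential growth by contraction of rates. -/

section GrigorchukGrowth

variable (ω : ℕ → Fin 3)

/-- The elements given by words with exactly `n` letters `a`. -/
def swapBall (n : ℕ) : Set (Equiv.Perm (List Bool)) :=
  {g | ∃ w, w.count none = n ∧ wordPerm ω w = g}

/-- The elements given by words with exactly `n` letters other than `a` and `z`. -/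
def otherBall (z : Fin 3) (n : ℕ) : Set (Equiv.Perm (List Bool)) :=
  {g | ∃ w, countOther z w = n ∧ wordPerm ω w = g}

/-- The map that fixes the root, permutes the vertices of level one according to `s`, and acts by
`f`, `g` on the subtrees. -/
def joinSections (s : Bool) (f g : List Bool → List Bool) : List Bool → List Bool
  | [] => []
  | false :: v => s :: f v
  | true :: v => (!s) :: g v

theorem rateLE_coe_image {E : ℕ → Set (Equiv.Perm (List Bool))} {r : ℝ} :
    RateLE (fun n => (fun g : Equiv.Perm (List Bool) => (g : List Bool → List Bool)) '' E n) r ↔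
      RateLE E r := by
  have hinj : Function.Injective
      (fun g : Equiv.Perm (List Bool) => (g : List Bool → List Bool)) := DFunLike.coe_injective
  unfold RateLE
  simp only [Set.ncard_image_of_injective _ hinj, Set.finite_image_iff hinj.injOn]

theorem RateLE.of_sections {E E' : ℕ → Set (Equiv.Perm (List Bool))} {r : ℝ} (hr : 1 ≤ r)
    (hE' : RateLE E' r)
    (h : ∀ n, ∀ g ∈ E n, g [] = [] ∧ ∃ s i j, i + j = n ∧ ∃ g₀ ∈ E' i, ∃ g₁ ∈ E' j,
      (∀ v, g (false :: v) = s :: g₀ v) ∧ ∀ v, g (true :: v) = (!s) :: g₁ v) : RateLE E r := by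
  rw [← rateLE_coe_image] at hE' ⊢
  refine hE'.of_pairs hr joinSections fun n x hx => ?_
  obtain ⟨g, hg, rfl⟩ := hx
  obtain ⟨hnil, s, i, j, hij, g₀, hg₀, g₁, hg₁, h0, h1⟩ := h n g hg
  refine ⟨s, i, j, hij, _, ⟨g₀, hg₀, rfl⟩, _, ⟨g₁, hg₁, rfl⟩, ?_⟩
  funext v
  match v with
  | [] => exact hnil.symm
  | false :: v => exact (h0 v).symm
  | true :: v => exact (h1 v).symm

/-- At level one, precisely the letters other than `a` and the current symbol leave an `a` in a
section, so the `a`-counts of the sections add up to n. -/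
theorem rateLE_otherBall_of_swapBall {r : ℝ} (hr : 1 ≤ r)
    (h : RateLE (swapBall (shiftSeq ω)) r) : RateLE (otherBall ω (ω 0)) r := by
  refine h.of_sections hr fun n g hg => ?_
  obtain ⟨w, hw, rfl⟩ := hg
  obtain ⟨s, w₀, w₁, h0, h1, -, ha⟩ := exists_sections ω w
  exact ⟨wordPerm_apply_nil _ _, s, _, _, ha.trans hw, _, ⟨w₀, rfl, rfl⟩, _, ⟨w₁, rfl, rfl⟩, h0, h1⟩

/-- Each directed letter passes to exactly one of the two sections, so the count is additive for
every `z`. Repeating this k times brings the symbol ω k to the front. -/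
theorem rateLE_otherBall_of_shift {r : ℝ} (hr : 1 ≤ r) (z : Fin 3)
    (h : RateLE (otherBall (shiftSeq ω) z) r) : RateLE (otherBall ω z) r := by
  refine h.of_sections hr fun n g hg => ?_
  obtain ⟨w, hw, rfl⟩ := hg
  obtain ⟨s, w₀, w₁, h0, h1, hz, -⟩ := exists_sections ω w
  exact ⟨wordPerm_apply_nil _ _, s, _, _, (hz z).trans hw, _, ⟨w₀, rfl, rfl⟩, _,
    ⟨w₁, rfl, rfl⟩, h0, h1⟩

theorem rateLE_otherBall {r : ℝ} (hr : 1 ≤ r)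
    (h : ∀ ω, ¬ EventuallyConst ω atTop → RateLE (swapBall ω) r) {ω : ℕ → Fin 3}
    (hω : ¬ EventuallyConst ω atTop) (k : ℕ) : RateLE (otherBall ω (ω k)) r := by
  induction k generalizing ω with
  | zero => exact rateLE_otherBall_of_swapBall ω hr (h _ (not_eventuallyConst_shiftSeq hω))
  | succ k ih =>
    exact rateLE_otherBall_of_shift ω hr _ (ih (not_eventuallyConst_shiftSeq hω))

/-- With `y` the third symbol, a slot holding a directed letter contributes exactly 2 to the left
side, and an empty slot contributes 1. -/
theorem exists_third_letter {z₁ z₂ : Fin 3} (h : z₁ ≠ z₂) :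
    ∃ y : Fin 3, ∀ us : List (Option (Fin 3)),
      us.countP (fun u => decide (u ≠ some y)) + countOther z₁ us + countOther z₂ us ≤
        2 * us.length := by
  have key : ∃ y : Fin 3, ∀ u : Option (Fin 3), (if u ≠ some y then 1 else 0) +
      (if u ≠ none ∧ u ≠ some z₁ then 1 else 0) + (if u ≠ none ∧ u ≠ some z₂ then 1 else 0) ≤ 2 := by
    revert z₁ z₂; decide
  obtain ⟨y, hy⟩ := key
  refine ⟨y, fun us => ?_⟩
  induction us with
  | nil => simp
  | cons u us ih =>
    have := hy u
    simp only [countOther, List.countP_cons, decide_eq_true_eq, List.length_cons] at ih ⊢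
    omega

/-- Chernoff-type bound for the number of sequences that mostly take the value `some y`. -/
theorem card_filter_countP_le {t : ℝ} (ht : 0 < t) (ht1 : t ≤ 1) (y : Fin 3) (N : ℕ) (s : ℝ) :
    (((Finset.univ : Finset (Fin N → Option (Fin 3))).filter fun f =>
      (((List.ofFn f).countP fun u => decide (u ≠ some y) : ℕ) : ℝ) ≤ s).card : ℝ) * t ^ s ≤
      (1 + 3 * t) ^ N := by
  -- Give weight `t` to each entry other than `some y`. All sequences together weigh (1 + 3t)^N, and
  -- each counted sequence weighs at least t^s.
  have hsum : ∑ u : Option (Fin 3), (if u ≠ some y then t else 1) = 1 + 3 * t := by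
    rw [Fintype.sum_option, Fin.sum_univ_three]
    fin_cases y <;> simp <;> ring
  have hprod : ∀ l : List (Option (Fin 3)),
      (l.map fun u => if u ≠ some y then t else 1).prod =
        t ^ (l.countP fun u => decide (u ≠ some y)) := by
    intro l
    induction l with
    | nil => simp
    | cons u l ih =>
      rw [List.map_cons, List.prod_cons, ih, List.countP_cons]
      by_cases hu : u = some y <;> simp [hu, pow_succ, mul_comm]
  rw [← hsum, Fintype.sum_pow, ← nsmul_eq_mul, ← Finset.sum_const]
  refine (Finset.sum_le_sum fun f hf => ?_).trans
    (Finset.sum_le_univ_sum_of_nonneg fun f => Finset.prod_nonneg fun i _ => by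
      split_ifs <;> linarith)
  rw [Finset.mem_filter] at hf
  rw [← List.prod_ofFn (f := fun i => if f i ≠ some y then t else 1)]
  have := hprod (List.ofFn f)
  rw [List.map_ofFn] at this
  refine le_of_le_of_eq ?_ this.symm
  rw [← Real.rpow_natCast]
  exact Real.rpow_le_rpow_of_exponent_ge ht ht1 hf.2

theorem exists_slots_of_mem_swapBall {g : Equiv.Perm (List Bool)} {n : ℕ} (hg : g ∈ swapBall ω n) :
    ∃ f : Fin (n + 1) → Option (Fin 3), wordPerm ω (none :: slotWord (List.ofFn f)) = g := by
  obtain ⟨w, rfl, rfl⟩ := hg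
  obtain ⟨us, hlen, hus⟩ := exists_slotWord ω w
  rw [← hlen]
  exact ⟨us.get, by rw [List.ofFn_get, wordPerm_cons, ← hus, ← mul_assoc, letterPerm_mul_self, one_mul]⟩

theorem rateLE_swapBall_four : RateLE (swapBall ω) 4 := by
  classical
  intro c hc
  refine ⟨4, fun n => ?_⟩
  refine finite_and_ncard_le (F := (Finset.univ : Finset (Fin (n + 1) → Option (Fin 3))).image
    fun f => wordPerm ω (none :: slotWord (List.ofFn f))) ?_ ?_
  · intro g hg
    obtain ⟨f, rfl⟩ := exists_slots_of_mem_swapBall ω hg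
    simp
  · refine (Nat.cast_le.2 Finset.card_image_le).trans ?_
    rw [Finset.card_univ, Fintype.card_fun, Fintype.card_option, Fintype.card_fin, Fintype.card_fin,
      pow_succ]
    push_cast
    have := pow_le_pow_left₀ (by norm_num : (0 : ℝ) ≤ 4) hc.le n
    linarith

/-- The order of choice matters: first `t` with 1 + 3t < r, then `ε` by continuity at 0, and finally
`c` just above `r`. -/
theorem exists_contraction_parameters {r : ℝ} (hr : 1 < r) :
    ∃ t ε c : ℝ, 0 < t ∧ t ≤ 1 ∧ 0 < ε ∧ ε < 1 ∧ r < c ∧ c ^ (1 - ε) < r ∧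
      (1 + 3 * t) * t ^ (-(2 * ε)) < r := by
  obtain ⟨t, ht, ht1, htr⟩ : ∃ t : ℝ, 0 < t ∧ t ≤ 1 ∧ 1 + 3 * t < r := by
    refine ⟨min 1 ((r - 1) / 6), lt_min one_pos (by linarith), min_le_left _ _, ?_⟩
    linarith [min_le_right 1 ((r - 1) / 6)]
  have hcont : ContinuousAt (fun ε : ℝ => (1 + 3 * t) * t ^ (-(2 * ε))) 0 := by
    refine continuousAt_const.mul (ContinuousAt.rpow continuousAt_const (by fun_prop) (Or.inl ht.ne'))
  have h1 : ∀ᶠ ε : ℝ in nhds 0, (1 + 3 * t) * t ^ (-(2 * ε)) < r :=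
    hcont.eventually_lt continuousAt_const (by simpa using htr)
  have h2 : ∀ᶠ ε : ℝ in nhdsWithin 0 (Set.Ioi 0), 0 < ε := self_mem_nhdsWithin
  obtain ⟨ε, ⟨h1, h3⟩, h2⟩ := (((h1.and (eventually_lt_nhds (zero_lt_one' ℝ))).filter_mono
    nhdsWithin_le_nhds).and h2).exists
  have hcont' : ContinuousAt (fun c : ℝ => c ^ (1 - ε)) r :=
    ContinuousAt.rpow continuousAt_id continuousAt_const (Or.inl (by simp; linarith))
  have h4 : ∀ᶠ c : ℝ in nhds r, c ^ (1 - ε) < r :=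
    hcont'.eventually_lt continuousAt_const (by
      calc r ^ (1 - ε) < r ^ (1 : ℝ) := Real.rpow_lt_rpow_of_exponent_lt hr (by linarith)
        _ = r := Real.rpow_one r)
  have h5 : ∀ᶠ c : ℝ in nhdsWithin r (Set.Ioi r), r < c := self_mem_nhdsWithin
  obtain ⟨c, h4, h5⟩ := ((h4.filter_mono nhdsWithin_le_nhds).and h5).exists
  exact ⟨t, ε, c, ht, ht1, h2, h3, h5, h4, h1⟩

/-- Fix two distinct symbols ω 0 and ω k. Elements whose slot word has at most (1 - ε)n letters
other than `a` and one of these symbols number about c^((1-ε)n). In all remaining slot words at most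
2εn + 2 slots differ from the third letter, and such words are few by the Chernoff-type bound. Both
rates are below `r`, with the same improvement for every ω. -/
theorem rateLE_swapBall_improve {r : ℝ} (hr : 1 < r)
    (h : ∀ ω, ¬ EventuallyConst ω atTop → RateLE (swapBall ω) r) :
    ∃ r', 1 ≤ r' ∧ r' < r ∧ ∀ ω, ¬ EventuallyConst ω atTop → RateLE (swapBall ω) r' := by
  classical
  obtain ⟨t, ε, c, ht, ht1, hε, hε1, hc, hcr, hρ⟩ := exists_contraction_parameters hr
  set r₁ := c ^ (1 - ε) with hr₁
  set r₂ := (1 + 3 * t) * t ^ (-(2 * ε)) with hr₂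
  refine ⟨max 1 (max r₁ r₂), le_max_left _ _, max_lt hr (max_lt hcr hρ), fun ω hω => ?_⟩
  set r' := max 1 (max r₁ r₂) with hr'
  have hr'1 : 1 ≤ r' := le_max_left _ _
  have hc1 : 1 ≤ c := by linarith
  obtain ⟨k, hk⟩ := exists_ne_of_not_eventuallyConst hω (ω 0)
  obtain ⟨K₁, hK₁⟩ := rateLE_otherBall hr.le h hω 0 c hc
  obtain ⟨K₂, hK₂⟩ := rateLE_otherBall hr.le h hω k c hc
  have hK₁0 := RateLE.const_nonneg hK₁
  have hK₂0 := RateLE.const_nonneg hK₂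
  obtain ⟨y, hy⟩ := exists_third_letter hk.symm
  -- This constant absorbs the extra slot in n + 1 and the `+ 2` in the threshold.
  set K₃ := (1 + 3 * t) * (t ^ (2 : ℝ))⁻¹ with hK₃
  have hK₃0 : 0 ≤ K₃ := by positivity
  refine rateLE_of_linear_mul (by linarith) fun c' hc' => ⟨K₁ + K₂ + K₃, fun n => ?_⟩
  set J := ⌊(1 - ε) * n⌋₊ with hJ
  have hJn : (J : ℝ) ≤ (1 - ε) * n := Nat.floor_le (mul_nonneg (by linarith) (Nat.cast_nonneg n))
  have hpow : ∀ K : ℝ, 0 ≤ K → K * ((J + 1) * c ^ J) ≤ K * ((n + 1) * c' ^ n) := by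
    intro K hK
    have h1 : c ^ J ≤ c' ^ n := by
      calc c ^ J = c ^ (J : ℝ) := (Real.rpow_natCast _ _).symm
        _ ≤ c ^ ((1 - ε) * n) := Real.rpow_le_rpow_of_exponent_le hc1 hJn
        _ = r₁ ^ n := by rw [Real.rpow_mul (by linarith), Real.rpow_natCast]
        _ ≤ c' ^ n := pow_le_pow_left₀ (by positivity)
            (((le_max_left _ _).trans (le_max_right _ _)).trans hc'.le) n
    have h2 : (J : ℝ) + 1 ≤ n + 1 := by nlinarith [(Nat.cast_nonneg n : (0 : ℝ) ≤ n)]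
    exact mul_le_mul_of_nonneg_left (mul_le_mul h2 h1 (by positivity) (by positivity)) hK
  have hfew : (((Finset.univ : Finset (Fin (n + 1) → Option (Fin 3))).filter fun f =>
      (((List.ofFn f).countP fun u => decide (u ≠ some y) : ℕ) : ℝ) ≤ 2 * ε * n + 2).card : ℝ) ≤
      K₃ * ((n + 1) * c' ^ n) := by
    have h1 := card_filter_countP_le ht ht1 y (n + 1) (2 * ε * n + 2)
    rw [← le_div_iff₀ (by positivity)] at h1
    refine h1.trans ?_
    have h2 : (1 + 3 * t) ^ (n + 1) / t ^ (2 * ε * n + 2) = K₃ * r₂ ^ n := by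
      rw [hK₃, hr₂, mul_pow, ← Real.rpow_natCast (t ^ _), ← Real.rpow_mul ht.le, Real.rpow_add ht,
        neg_mul, Real.rpow_neg ht.le, pow_succ, div_eq_mul_inv, mul_inv]
      ring
    rw [h2]
    have h3 : r₂ ^ n ≤ c' ^ n := pow_le_pow_left₀ (by positivity)
      (((le_max_right _ _).trans (le_max_right _ _)).trans hc'.le) n
    refine mul_le_mul_of_nonneg_left (h3.trans (le_mul_of_one_le_left ?_ ?_)) hK₃0
    · exact pow_nonneg (by linarith) n
    · linarith [(Nat.cast_nonneg n : (0 : ℝ) ≤ n)]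
  refine finite_and_ncard_le (F := ((Finset.range (J + 1)).biUnion fun i => (hK₁ i).1.toFinset) ∪
    ((Finset.range (J + 1)).biUnion fun i => (hK₂ i).1.toFinset) ∪
    ((Finset.univ : Finset (Fin (n + 1) → Option (Fin 3))).filter fun f =>
      (((List.ofFn f).countP fun u => decide (u ≠ some y) : ℕ) : ℝ) ≤ 2 * ε * n + 2).image
      fun f => wordPerm ω (none :: slotWord (List.ofFn f))) ?_ ?_
  · intro g hg
    obtain ⟨f, rfl⟩ := exists_slots_of_mem_swapBall ω hg
    set us := List.ofFn f with hus
    have hmem : ∀ z, wordPerm ω (none :: slotWord us) ∈ otherBall ω z (countOther z us) := fun z =>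
      ⟨_, by rw [countOther_none, countOther_slotWord], rfl⟩
    simp only [Finset.coe_union, Finset.coe_biUnion, Finset.coe_image, Set.mem_union,
      Set.mem_iUnion, Finset.coe_range, Set.mem_Iio, Set.Finite.coe_toFinset]
    by_cases h1 : countOther (ω 0) us ≤ J
    · exact Or.inl (Or.inl ⟨_, by omega, hmem _⟩)
    by_cases h2 : countOther (ω k) us ≤ J
    · exact Or.inl (Or.inr ⟨_, by omega, hmem _⟩)
    refine Or.inr ⟨f, ?_, rfl⟩
    have h3 := hy us
    rw [hus, List.length_ofFn, ← hus] at h3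
    rw [not_le, Nat.floor_lt' (by omega)] at h1 h2
    have h4 : ((us.countP fun u => decide (u ≠ some y) : ℕ) : ℝ) + countOther (ω 0) us +
        countOther (ω k) us ≤ 2 * (n + 1) := by exact_mod_cast h3
    simp only [Finset.coe_filter, Finset.mem_univ, true_and, Set.mem_ofPred_eq]
    linarith
  · refine (Nat.cast_le.2 ((Finset.card_union_le _ _).trans
      (Nat.add_le_add_right (Finset.card_union_le _ _) _))).trans ?_
    push_cast
    have h1 := (card_biUnion_range_le hc1 hK₁ J).trans (hpow K₁ hK₁0)
    have h2 := (card_biUnion_range_le hc1 hK₂ J).trans (hpow K₂ hK₂0)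
    have h3 := (Nat.cast_le (α := ℝ).2 (Finset.card_image_le (f := fun f =>
      wordPerm ω (none :: slotWord (List.ofFn f))))).trans hfew
    rw [add_mul, add_mul]
    exact add_le_add (add_le_add h1 h2) h3

/-- The infimum of the uniform rate bounds is itself a bound, because `RateLE` only tests bases
above `r`. An infimum above 1 could be improved. -/
theorem rateLE_swapBall_one {ω : ℕ → Fin 3} (hω : ¬ EventuallyConst ω atTop) :
    RateLE (swapBall ω) 1 := by
  set T : Set ℝ := {r | 1 ≤ r ∧ ∀ ω, ¬ EventuallyConst ω atTop → RateLE (swapBall ω) r} with hT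
  have hne : T.Nonempty := ⟨4, by norm_num, fun ω _ => rateLE_swapBall_four ω⟩
  have hbdd : BddBelow T := ⟨1, fun r hr => hr.1⟩
  have hmem : sInf T ∈ T := by
    refine ⟨le_csInf hne fun r hr => hr.1, fun ω hω c hc => ?_⟩
    obtain ⟨r, hr, hrc⟩ := exists_lt_of_csInf_lt hne hc
    exact hr.2 ω hω c hrc
  have hone : sInf T = 1 := by
    by_contra hne1
    obtain ⟨r', h1, h2, h3⟩ :=
      rateLE_swapBall_improve (lt_of_le_of_ne hmem.1 (Ne.symm hne1)) hmem.2
    exact absurd (csInf_le hbdd ⟨h1, h3⟩) (not_le.2 h2)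
  exact hone ▸ hmem.2 ω hω

theorem mem_swapBall_of_wordLength_le (n : ℕ) (g : grigorchukGroup ω)
    (hg : wordLength (grigorchukGens ω) g ≤ n) :
    ∃ j ≤ n, (g : Equiv.Perm (List Bool)) ∈ swapBall ω j := by
  obtain ⟨l, hl, rfl, hlen⟩ := exists_list_prod_eq (closure_grigorchukGens ω) g
  suffices H : ∃ w : List (Option (Fin 3)), w.length = l.length ∧
      ((l.prod : grigorchukGroup ω) : Equiv.Perm (List Bool)) = wordPerm ω w by
    obtain ⟨w, hw, hp⟩ := H
    exact ⟨_, List.count_le_length.trans (hw.trans hlen |>.le.trans hg), w, rfl, hp.symm⟩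
  clear hlen hg
  induction l with
  | nil => exact ⟨[], rfl, rfl⟩
  | cons x l ih =>
    obtain ⟨w, hw, hp⟩ := ih fun y hy => hl y (List.mem_cons_of_mem _ hy)
    obtain ⟨u, hu⟩ : ∃ u, (x : Equiv.Perm (List Bool)) = letterPerm ω u := by
      rcases hl x (by simp) with h | h
      · exact exists_letterPerm_eq ω h
      · obtain ⟨u, hu⟩ := exists_letterPerm_eq ω h
        exact ⟨u, by rw [← letterPerm_inv, ← hu]; simp⟩
    exact ⟨u :: w, by simp [hw], by
      rw [List.prod_cons, Subgroup.coe_mul, hp, hu, wordPerm_cons]⟩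

theorem growthFunction_isLittleO {ω : ℕ → Fin 3} (hω : ¬ EventuallyConst ω atTop) {c : ℝ}
    (hc : 1 < c) : (fun n : ℕ => (growthFunction (grigorchukGens ω) n : ℝ)) =o[atTop]
      (fun n : ℕ => c ^ n) := by
  classical
  have hrate : RateLE (fun n => {g : grigorchukGroup ω |
      wordLength (grigorchukGens ω) g ≤ n}) 1 := by
    refine rateLE_of_linear_mul one_pos fun c hc => ?_
    obtain ⟨K, hK⟩ := rateLE_swapBall_one hω c hc
    refine ⟨K, fun n => ?_⟩
    rw [← Set.ncard_image_of_injective _ Subtype.val_injective,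
      ← Set.finite_image_iff Subtype.val_injective.injOn]
    refine finite_and_ncard_le ?_ (card_biUnion_range_le hc.le hK n)
    rintro _ ⟨g, hg, rfl⟩
    obtain ⟨j, hj, hmem⟩ := mem_swapBall_of_wordLength_le ω n g hg
    simp only [Finset.coe_biUnion, Set.mem_iUnion, Finset.coe_range, Set.mem_Iio,
      Set.Finite.coe_toFinset]
    exact ⟨j, by omega, hmem⟩
  obtain ⟨c', h1, h2⟩ := exists_between hc
  obtain ⟨K, hK⟩ := hrate c' h1
  refine IsBigO.trans_isLittleO (g := fun n : ℕ => c' ^ n) (IsBigO.of_bound K ?_)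
    (isLittleO_pow_pow_of_lt_left (by linarith) h2)
  filter_upwards with n
  rw [Real.norm_of_nonneg (by positivity), Real.norm_of_nonneg (pow_nonneg (by linarith) _)]
  exact (hK n).2

end GrigorchukGrowth

/-- The lower bound also contains the existence of Følner sets: without them `folnerFunction` would
be 0, below the positive number 2^(Cn). -/
theorem mainTheorem7 :
    ∃ C : ℝ, 0 < C ∧
      ∀ ω : ℕ → Fin 3, ¬ EventuallyConst ω atTop →
        (∀ n : ℕ, 2 ≤ n →
          (2 : ℝ) ^ (C * (n : ℝ)) ≤ (folnerFunction (grigorchukGens ω) n : ℝ)) ∧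
        HasIntermediateGrowth (grigorchukGens ω) := by
  refine ⟨1 / 1024, by norm_num, fun ω hω => ?_⟩
  have hfin := finite_grigorchukGens ω
  have hgen := closure_grigorchukGens ω
  have hsub : ∀ c : ℝ, 1 < c → (fun n : ℕ => (growthFunction (grigorchukGens ω) n : ℝ)) =o[atTop]
      (fun n : ℕ => c ^ n) := fun c hc => growthFunction_isLittleO hω hc
  have hfol : ∀ n : ℕ, 2 ≤ n →
      (2 : ℝ) ^ ((1 / 1024 : ℝ) * (n : ℝ)) ≤ (folnerFunction (grigorchukGens ω) n : ℝ) :=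
    fun n hn => two_pow_le_folnerFunction hω hn
      (exists_folner_of_subexponential hfin hgen hsub (by omega))
  -- Subexponential growth gave the Følner sets behind `hfol`, and `hfol` in turn gives
  -- superpolynomial growth.
  exact ⟨hfol, pow_isLittleO_growthFunction hfin hgen (by norm_num) (by norm_num) hfol, hsub⟩
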